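/- Let $E=(E_0,E_1,s,r)$ be a finite directed graph with a distinguished vertex $\bar v$ emitting a loop $\bar e$. Assume that $E$ is $\bar v$-trimmable, i.e. $s^{-1}(\bar v)=\{\bar e\}$, $r^{-1}(\bar v)\setminus\{\bar e\}\neq\emptyset$, and $s^{-1}(v)\setminus r^{-1}(\bar v)\neq\emptyset$ for every $v\in s\big(r^{-1}(\bar v)\setminus\{\bar e\}\big)$. Let $E'$ be the subgraph of $E$ obtained by removing the loop $\bar e$, and let $E''$ be the subgraph of $E'$ obtained by removing the vertex $\bar v$ and all edges ending in $\bar v$. For a row-finite graph $F$, let $C^*(F)$ denote the graph C*-algebra of $F$, i.e. the universal C*-algebra generated by mutually orthogonal projections $P_v$ ($v\in F_0$) and partial isometries $S_e$ ($e\in F_1$) with $S_e^*S_e=P_{r(e)}$ for all $e\in F_1$ and $\sum_{s(e)=v}S_eS_e^*=P_v$ for all $v\in F_0$ that are not sinks. Let $C^*(F)^{U(1)}$ be the fixed-point subalgebra of the gauge action $\alpha_\lambda(P_v)=P_v$, $\alpha_\lambda(S_e)=\lambda S_e$, $\lambda\in U(1)$. Let $\pi_1\colon C^*(E)\to C^*(E'')$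 and $\pi_2\colon C^*(E')\to C^*(E'')$ be the quotient maps, which send the generators $P_v$, $S_e$ with $v$, $e$ in $E''$ to the generators of the same name and all other generators to $0$. Let $f\colon C^*(E)\to C^*(E')\otimes C(S^1)$ be the $*$-homomorphism with $f(P_v)=P_v\otimes 1$ for $v\in E_0$, $f(S_e)=S_e\otimes u$ for $e\neq\bar e$, and $f(S_{\bar e})=P_{\bar v}\otimes u$, where $u$ is the standard unitary generator of $C(S^1)$. Both $\pi_1$ and $f$ are $U(1)$-equivariant, where $U(1)$ acts on $C^*(E')\otimes C(S^1)$ through the standard action on $C(S^1)$, so that $\big(C^*(E')\otimes C(S^1)\big)^{U(1)}=C^*(E')\otimes 1\cong C^*(E')$. Let $$\widetilde{\pi_1}\colon C^*(E)^{U(1)}\to C^*(E'')^{U(1)},\qquad \widetilde f\colon C^*(E)^{U(1)}\to C^*(E')$$ be the restrictions-corestrictions of $\pi_1$ and $f$ to the fixed-point subalgebras, and let $\iota\colon C^*(E'')^{U(1)}\to C^*(E'')$ be the inclusion. Then the square of $*$-homomorphisms formed by $\widetilde{\pi_1}$, $\widetilde f$, $\iota$ and $\pi_2$ is a pullback diagram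 of C*-algebras. That is, $\iota\circ\widetilde{\pi_1}=\pi_2\circ\widetilde f$, and $x\mapsto(\widetilde{\pi_1}(x),\widetilde f(x))$ is an isomorphism from $C^*(E)^{U(1)}$ onto the pullback C*-algebra $$\{(b,c)\in C^*(E'')^{U(1)}\times C^*(E')\;:\;\iota(b)=\pi_2(c)\}.$$ -/

import Mathlib

set_option linter.unusedSectionVars false

noncomputable section

/-! ### Completion of a non-unital *-algebra with a C*-seminorm -/

/-- The Hausdorff completion of a (non-unital) `*`-algebra with respect to a C*-seminorm. -/
def CStarCompletion (F : Type*) [UniformSpace F] : Type _ := UniformSpace.Completion F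

/-- The seminorm of the algebra satisfies the C*-identity. -/
class HasCStarSeminorm (F : Type*) [NonUnitalSeminormedRing F] [StarRing F] : Prop where
  norm_star_mul_self : ∀ x : F, ‖star x * x‖ = ‖x‖ * ‖x‖

namespace CStarCompletion

open UniformSpace UniformSpace.Completion IsDenseInducing

variable {F : Type*} [NonUnitalSeminormedRing F]

instance : NormedAddCommGroup (CStarCompletion F) :=
  inferInstanceAs (NormedAddCommGroup (Completion F))

instance : CompleteSpace (CStarCompletion F) :=
  inferInstanceAs (CompleteSpace (Completion F))

instance [NormedSpace ℂ F] : NormedSpace ℂ (CStarCompletion F) :=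
  inferInstanceAs (NormedSpace ℂ (Completion F))

/-- The canonical map of the algebra into its completion. -/
def coe (x : F) : CStarCompletion F := (x : Completion F)

theorem continuous_coe : Continuous (coe : F → CStarCompletion F) :=
  Completion.continuous_coe F

theorem isDenseInducing_coe : IsDenseInducing (coe : F → CStarCompletion F) :=
  Completion.isDenseInducing_coe

theorem norm_coe (x : F) : ‖coe x‖ = ‖x‖ := Completion.norm_coe x

theorem coe_add (x y : F) : coe (x + y) = coe x + coe y := Completion.coe_add x y

theorem coe_zero : coe (0 : F) = 0 := rfl

theorem coe_sub (x y : F) : coe (x - y) = coe x - coe y := Completion.coe_sub x y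

theorem coe_smul [NormedSpace ℂ F] (c : ℂ) (x : F) : coe (c • x) = c • coe x :=
  Completion.coe_smul c x

@[elab_as_elim]
theorem ind {p : CStarCompletion F → Prop} (a : CStarCompletion F) (hp : IsClosed {a | p a})
    (h : ∀ x : F, p (coe x)) : p a := Completion.induction_on a hp h

@[elab_as_elim]
theorem ind₂ {p : CStarCompletion F → CStarCompletion F → Prop} (a b : CStarCompletion F)
    (hp : IsClosed {x : CStarCompletion F × CStarCompletion F | p x.1 x.2})
    (h : ∀ x y : F, p (coe x) (coe y)) : p a b := Completion.induction_on₂ a b hp h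

@[elab_as_elim]
theorem ind₃ {p : CStarCompletion F → CStarCompletion F → CStarCompletion F → Prop}
    (a b c : CStarCompletion F)
    (hp : IsClosed {x : CStarCompletion F × CStarCompletion F × CStarCompletion F |
      p x.1 x.2.1 x.2.2})
    (h : ∀ x y z : F, p (coe x) (coe y) (coe z)) : p a b c := Completion.induction_on₃ a b c hp h

/-- Multiplication is extended by continuity. -/
instance : Mul (CStarCompletion F) :=
  ⟨fun a b => ((isDenseInducing_coe (F := F)).prodMap (isDenseInducing_coe (F := F))).extend
    (fun p : F × F => coe (p.1 * p.2)) (a, b)⟩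

theorem coe_mul (x y : F) : coe (x * y) = coe x * coe y :=
  ((isDenseInducing_coe.prodMap isDenseInducing_coe).extend_eq
      (continuous_coe.comp (continuous_mul (M := F))) (x, y)).symm

instance : ContinuousMul (CStarCompletion F) where
  continuous_mul := by
    let m : F →+ F →+ CStarCompletion F :=
      (AddMonoidHom.mul : F →+ F →+ F).compr₂ (toCompl : F →+ Completion F)
    have : Continuous fun p : F × F => m p.1 p.2 := continuous_coe.comp continuous_mul
    have di : IsDenseInducing (toCompl : F → Completion F) := isDenseInducing_coe
    exact (di.extend_Z_bilin di this :)

instance : NonUnitalRing (CStarCompletion F) where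
  zero_mul a := ind a (isClosed_eq (by fun_prop) continuous_const)
    fun a => by rw [← coe_zero, ← coe_mul, zero_mul]
  mul_zero a := ind a (isClosed_eq (by fun_prop) continuous_const)
    fun a => by rw [← coe_zero, ← coe_mul, mul_zero]
  mul_assoc a b c := ind₃ a b c (isClosed_eq (by fun_prop) (by fun_prop))
    fun a b c => by simp only [← coe_mul, mul_assoc]
  left_distrib a b c := ind₃ a b c (isClosed_eq (by fun_prop) (by fun_prop))
    fun a b c => by simp only [← coe_mul, ← coe_add, mul_add]
  right_distrib a b c := ind₃ a b c (isClosed_eq (by fun_prop) (by fun_prop))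
    fun a b c => by simp only [← coe_mul, ← coe_add, add_mul]

instance : NonUnitalNormedRing (CStarCompletion F) where
  dist_eq := (inferInstance : NormedAddCommGroup (CStarCompletion F)).dist_eq
  norm_mul_le a b := ind₂ a b
    (isClosed_le (continuous_norm.comp continuous_mul)
      ((continuous_norm.comp continuous_fst).mul (continuous_norm.comp continuous_snd)))
    fun a b => by simp only [← coe_mul, norm_coe]; exact norm_mul_le a b

variable [StarRing F] [HasCStarSeminorm F]

/-- The involution is extended by continuity. -/
instance : Star (CStarCompletion F) := ⟨Completion.map (star : F → F)⟩

theorem norm_star' (x : F) : ‖star x‖ = ‖x‖ := by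
  have key : ∀ y : F, ‖y‖ ≤ ‖star y‖ := fun y => by
    rcases (norm_nonneg y).eq_or_lt with h | h
    · rw [← h]; exact norm_nonneg _
    · refine le_of_mul_le_mul_right ?_ h
      rw [← HasCStarSeminorm.norm_star_mul_self]
      exact norm_mul_le _ _
  exact le_antisymm (by simpa using key (star x)) (key x)

theorem uniformContinuous_star' : UniformContinuous (star : F → F) :=
  (AddMonoidHomClass.lipschitz_of_bound (starAddEquiv : F ≃+ F) 1
    (fun x => by simp [norm_star'])).uniformContinuous

theorem coe_star (x : F) : coe (star x) = star (coe x) :=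
  (Completion.map_coe uniformContinuous_star' x).symm

theorem continuous_star' : Continuous (star : CStarCompletion F → CStarCompletion F) :=
  Completion.continuous_map (f := (star : F → F))

variable [NormedSpace ℂ F] [IsScalarTower ℂ F F] [SMulCommClass ℂ F F] [StarModule ℂ F]

instance : StarRing (CStarCompletion F) where
  star_involutive a := ind a (isClosed_eq (continuous_star'.comp continuous_star') continuous_id)
    fun a => by simp only [← coe_star, star_star]
  star_mul a b := ind₂ a b
    (isClosed_eq (continuous_star'.comp (by fun_prop))
      ((continuous_star'.comp continuous_snd).mul (continuous_star'.comp continuous_fst)))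
    fun a b => by simp only [← coe_star, ← coe_mul, star_mul]
  star_add a b := ind₂ a b
    (isClosed_eq (continuous_star'.comp (by fun_prop))
      ((continuous_star'.comp continuous_fst).add (continuous_star'.comp continuous_snd)))
    fun a b => by simp only [← coe_star, ← coe_add, star_add]

instance : CStarRing (CStarCompletion F) where
  norm_mul_self_le a := ind a
    (isClosed_le (continuous_norm.mul continuous_norm) (continuous_star'.mul continuous_id).norm)
    fun a => by
      simp only [← coe_star, ← coe_mul, norm_coe]
      exact (HasCStarSeminorm.norm_star_mul_self a).ge

instance : IsScalarTower ℂ (CStarCompletion F) (CStarCompletion F) where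
  smul_assoc c a b := ind₂ a b
    (isClosed_eq ((continuous_fst.const_smul c).mul continuous_snd) (continuous_mul.const_smul c))
    fun a b => by
      rw [smul_eq_mul, smul_eq_mul, ← coe_smul, ← coe_mul, ← coe_mul, ← coe_smul, smul_mul_assoc]

instance : SMulCommClass ℂ (CStarCompletion F) (CStarCompletion F) where
  smul_comm c a b := ind₂ a b
    (isClosed_eq (continuous_mul.const_smul c) (continuous_fst.mul (continuous_snd.const_smul c)))
    fun a b => by
      rw [smul_eq_mul, smul_eq_mul, ← coe_smul, ← coe_mul, ← coe_mul, ← coe_smul, mul_smul_comm]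

instance : StarModule ℂ (CStarCompletion F) where
  star_smul c a := ind a
    (isClosed_eq (continuous_star'.comp (continuous_id.const_smul c))
      (show Continuous fun a : CStarCompletion F => star c • star a from
        continuous_star'.const_smul (star c)))
    fun a => by rw [← coe_smul, ← coe_star, ← coe_star, star_smul, ← coe_smul]

/-- The completion of a `*`-algebra with respect to a C*-seminorm is a C*-algebra. -/
instance : NonUnitalCStarAlgebra (CStarCompletion F) where
  norm_smul_le := norm_smul_le

/-- A norm-decreasing `*`-homomorphism into a C*-algebra extends to the completion. -/
def extendHom {B : Type*} [NonUnitalCStarAlgebra B] (φ : F →⋆ₙₐ[ℂ] B) (hφ : ∀ x, ‖φ x‖ ≤ ‖x‖) :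
    CStarCompletion F →⋆ₙₐ[ℂ] B :=
  have hu : UniformContinuous φ :=
    (AddMonoidHomClass.lipschitz_of_bound φ 1 (by simpa using hφ)).uniformContinuous
  have hc : Continuous (Completion.extension φ : CStarCompletion F → B) :=
    Completion.continuous_extension
  have he : ∀ x : F, (Completion.extension φ : CStarCompletion F → B) (coe x) = φ x :=
    fun x => Completion.extension_coe hu x
  { toFun := (Completion.extension φ : CStarCompletion F → B)
    map_smul' := fun c a => ind a (isClosed_eq (hc.comp (continuous_id.const_smul c))
        (hc.const_smul _))
      fun a => by rw [← coe_smul, he, he]; exact map_smul φ c a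
    map_zero' := by rw [← coe_zero, he, map_zero]
    map_add' := fun a b => ind₂ a b (isClosed_eq (hc.comp (continuous_add (M := CStarCompletion F)))
        ((hc.comp continuous_fst).add (hc.comp continuous_snd)))
      fun a b => by rw [← coe_add, he, he, he, map_add]
    map_mul' := fun a b => ind₂ a b (isClosed_eq (hc.comp (continuous_mul (M := CStarCompletion F)))
        ((hc.comp continuous_fst).mul (hc.comp continuous_snd)))
      fun a b => by rw [← coe_mul, he, he, he, map_mul]
    map_star' := fun a => ind a (isClosed_eq (hc.comp continuous_star') hc.star)
      fun a => by rw [← coe_star, he, he, map_star] }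

theorem extendHom_coe {B : Type*} [NonUnitalCStarAlgebra B] (φ : F →⋆ₙₐ[ℂ] B)
    (hφ : ∀ x, ‖φ x‖ ≤ ‖x‖) (x : F) : extendHom φ hφ (coe x) = φ x :=
  Completion.extension_coe
    (AddMonoidHomClass.lipschitz_of_bound φ 1 (by simpa using hφ)).uniformContinuous x

end CStarCompletion

/-! ### Directed graphs and Cuntz–Krieger families -/

/-- A directed graph with vertices `V`, edges `W`, source map `src` and range map `rng`. -/
structure DirectedGraph (V W : Type*) where
  src : W → V
  rng : W → V

namespace DirectedGraph

variable {V W : Type*}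

/-- The defining relations of a Cuntz–Krieger family, with equality replaced by a relation `r`:
the `P v` are mutually orthogonal projections, the `S e` are partial isometries, and (CK1), (CK2)
hold. -/
structure CKRelations (E : DirectedGraph V W) {A : Type*} [NonUnitalRing A] [Star A]
    (r : A → A → Prop) (P : V → A) (S : W → A) : Prop where
  star_proj : ∀ v, r (star (P v)) (P v)
  proj_mul_proj : ∀ v, r (P v * P v) (P v)
  orthogonal : ∀ v w, v ≠ w → r (P v * P w) 0
  partialIsometry : ∀ e, r (S e * star (S e) * S e) (S e)
  ck1 : ∀ e, r (star (S e) * S e) (P (E.rng e))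
  ck2 : ∀ v (t : Finset W), (∀ e, e ∈ t ↔ E.src e = v) → t.Nonempty →
    r (∑ e ∈ t, S e * star (S e)) (P v)

/-- A Cuntz–Krieger `E`-family in a `*`-algebra. -/
abbrev IsCKFamily (E : DirectedGraph V W) {A : Type*} [NonUnitalRing A] [Star A]
    (P : V → A) (S : W → A) : Prop :=
  E.CKRelations (· = ·) P S

/-! ### The free `*`-algebra on the vertices and edges -/

/-- Letters: the generators (with flag `false`) and their formal adjoints (with flag `true`). -/
abbrev Letter (V W : Type*) : Type _ := (V ⊕ W) × Bool

/-- The formal adjoint of a word. -/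
def wordStar : FreeSemigroup (Letter V W) →ₙ* (FreeSemigroup (Letter V W))ᵐᵒᵖ :=
  FreeSemigroup.lift fun x => MulOpposite.op (FreeSemigroup.of (x.1, !x.2))

theorem wordStar_wordStar (w : FreeSemigroup (Letter V W)) :
    (wordStar (wordStar w).unop).unop = w := by
  induction w using FreeSemigroup.recOnMul with
  | ih1 x => simp [wordStar]
  | ih2 x y hx hy => 
    rw [map_mul, MulOpposite.unop_mul, map_mul, MulOpposite.unop_mul, hx, hy]

/-- The free non-unital `*`-algebra over `ℂ` generated by the vertices and edges of `E`. -/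
def FreeStarAlg (_E : DirectedGraph V W) : Type _ := MonoidAlgebra ℂ (FreeSemigroup (Letter V W))

namespace FreeStarAlg

variable (E : DirectedGraph V W)

instance : NonUnitalRing E.FreeStarAlg :=
  inferInstanceAs (NonUnitalRing (MonoidAlgebra ℂ (FreeSemigroup (Letter V W))))

instance : Module ℂ E.FreeStarAlg :=
  inferInstanceAs (Module ℂ (MonoidAlgebra ℂ (FreeSemigroup (Letter V W))))

instance : IsScalarTower ℂ E.FreeStarAlg E.FreeStarAlg :=
  inferInstanceAs (IsScalarTower ℂ (MonoidAlgebra ℂ (FreeSemigroup (Letter V W)))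
    (MonoidAlgebra ℂ (FreeSemigroup (Letter V W))))

instance : SMulCommClass ℂ E.FreeStarAlg E.FreeStarAlg :=
  inferInstanceAs (SMulCommClass ℂ (MonoidAlgebra ℂ (FreeSemigroup (Letter V W)))
    (MonoidAlgebra ℂ (FreeSemigroup (Letter V W))))

/-- The element `c • w` for a scalar `c` and a word `w`. -/
def mono (w : FreeSemigroup (Letter V W)) (c : ℂ) : E.FreeStarAlg := MonoidAlgebra.single w c

variable {E}

@[elab_as_elim]
theorem ind {p : E.FreeStarAlg → Prop} (x : E.FreeStarAlg) (zero : p 0)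
    (add : ∀ x y, p x → p y → p (x + y)) (mono : ∀ w c, p (mono E w c)) : p x :=
  MonoidAlgebra.induction_linear x zero (fun x y => add x y) mono

theorem mono_mul_mono (w w' : FreeSemigroup (Letter V W)) (c c' : ℂ) :
    mono E w c * mono E w' c' = mono E (w * w') (c * c') :=
  MonoidAlgebra.single_mul_single ..

theorem smul_mono (w : FreeSemigroup (Letter V W)) (c c' : ℂ) :
    c • mono E w c' = mono E w (c * c') :=
  MonoidAlgebra.smul_single ..

/-- The involution: conjugate-linear and reversing words, exchanging letters and adjoints. -/
def starHom : E.FreeStarAlg →+ E.FreeStarAlg :=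
  (Finsupp.liftAddHom fun w =>
    ((MonoidAlgebra.singleAddHom (wordStar w).unop).comp
      (starAddEquiv : ℂ ≃+ ℂ).toAddMonoidHom)).comp
    (MonoidAlgebra.coeffAddEquiv (R := ℂ) (M := FreeSemigroup (Letter V W))).toAddMonoidHom

instance : Star E.FreeStarAlg := ⟨starHom⟩

theorem star_mono (w : FreeSemigroup (Letter V W)) (c : ℂ) :
    star (mono E w c) = mono E (wordStar w).unop (star c) := by
  change Finsupp.liftAddHom (fun w : FreeSemigroup (Letter V W) =>
    ((MonoidAlgebra.singleAddHom (R := ℂ) (wordStar w).unop).comp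
      (starAddEquiv : ℂ ≃+ ℂ).toAddMonoidHom)) (MonoidAlgebra.single w c).coeff = _
  rw [MonoidAlgebra.coeff_single, Finsupp.liftAddHom_apply_single]
  rfl

theorem star_add' (x y : E.FreeStarAlg) : star (x + y) = star x + star y := map_add starHom x y

theorem star_zero' : star (0 : E.FreeStarAlg) = 0 := map_zero starHom

instance : StarRing E.FreeStarAlg where
  star_involutive x := by
    induction x using ind with
    | zero => simp only [star_zero']
    | add x y hx hy => rw [star_add', star_add', hx, hy]
    | mono w c => rw [star_mono, star_mono, wordStar_wordStar, star_star]
  star_add := star_add'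
  star_mul x y := by
    induction x using ind with
    | zero => simp only [star_zero', zero_mul, mul_zero]
    | add x x' hx hx' => simp only [add_mul, star_add', mul_add, hx, hx']
    | mono w c =>
      induction y using ind with
      | zero => simp only [star_zero', zero_mul, mul_zero]
      | add x x' hx hx' => simp only [add_mul, star_add', mul_add, hx, hx']
      | mono w' c' =>
        simp only [mono_mul_mono, star_mono, map_mul, MulOpposite.unop_mul, star_mul]

instance : StarModule ℂ E.FreeStarAlg where
  star_smul c x := by
    induction x using ind with
    | zero => simp only [star_zero', smul_zero]
    | add x x' hx hx' => simp only [smul_add, star_add', hx, hx']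
    | mono w c' => simp only [smul_mono, star_mono, star_mul']

/-- The generators corresponding to vertices and edges. -/
def gen (x : V ⊕ W) : E.FreeStarAlg := mono E (FreeSemigroup.of (x, false)) 1

theorem star_gen (x : V ⊕ W) :
    star (gen x : E.FreeStarAlg) = mono E (FreeSemigroup.of (x, true)) 1 := by
  simp [gen, star_mono, wordStar]

section eval

variable {B : Type*} [NonUnitalRing B] [StarRing B] [Module ℂ B] [IsScalarTower ℂ B B]
  [SMulCommClass ℂ B B] [StarModule ℂ B]

/-- Evaluation of words at elements of a `*`-algebra. -/
def evalWord (g : V ⊕ W → B) : FreeSemigroup (Letter V W) →ₙ* B :=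
  FreeSemigroup.lift fun x => if x.2 then star (g x.1) else g x.1

theorem evalWord_wordStar (g : V ⊕ W → B) (w : FreeSemigroup (Letter V W)) :
    evalWord g (wordStar w).unop = star (evalWord g w) := by
  induction w using FreeSemigroup.recOnMul with
  | ih1 x => obtain ⟨x, b⟩ := x; cases b <;> simp [wordStar, evalWord]
  | ih2 x y hx hy =>
    rw [map_mul, MulOpposite.unop_mul, map_mul, map_mul, hx, hy, star_mul]

/-- Evaluation of the free `*`-algebra, as an algebra homomorphism. -/
def evalAlg (g : V ⊕ W → B) : E.FreeStarAlg →ₙₐ[ℂ] B := MonoidAlgebra.liftMagma ℂ (evalWord g)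

theorem evalAlg_mono (g : V ⊕ W → B) (w : FreeSemigroup (Letter V W)) (c : ℂ) :
    evalAlg g (mono E w c) = c • evalWord g w := by
  change Finsupp.liftAddHom (fun x => (smulAddHom ℂ B).flip (evalWord g x))
    (MonoidAlgebra.single w c).coeff = _
  rw [MonoidAlgebra.coeff_single, Finsupp.liftAddHom_apply_single]
  rfl

/-- Evaluation of the free `*`-algebra at elements of a `*`-algebra. -/
def eval (g : V ⊕ W → B) : E.FreeStarAlg →⋆ₙₐ[ℂ] B :=
  { evalAlg g with
    map_star' := fun x => by
      change evalAlg g (star x) = star (evalAlg g x)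
      induction x using ind with
      | zero => rw [star_zero', map_zero, star_zero]
      | add x y hx hy => rw [star_add', map_add, map_add, star_add, hx, hy]
      | mono w c => rw [star_mono, evalAlg_mono, evalAlg_mono, star_smul, evalWord_wordStar] }

theorem eval_gen (g : V ⊕ W → B) (x : V ⊕ W) :
    (eval g : E.FreeStarAlg →⋆ₙₐ[ℂ] B) (gen x) = g x := by
  change evalAlg g (mono E _ _) = _
  rw [evalAlg_mono, one_smul]
  simp [evalWord]

end eval

/-- Every element is obtained from the generators by the `*`-algebra operations. -/
@[elab_as_elim]
theorem gen_ind {p : E.FreeStarAlg → Prop} (x : E.FreeStarAlg) (zero : p 0)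
    (add : ∀ x y, p x → p y → p (x + y)) (mul : ∀ x y, p x → p y → p (x * y))
    (smul : ∀ (c : ℂ) x, p x → p (c • x)) (star_mem : ∀ x, p x → p (star x))
    (gen_mem : ∀ x, p (gen x)) : p x := by
  induction x using ind with
  | zero => exact zero
  | add x y hx hy => exact add x y hx hy
  | mono w c =>
    have : mono E w c = c • mono E w 1 := by rw [smul_mono, mul_one]
    rw [this]
    refine smul c _ ?_
    clear this
    induction w using FreeSemigroup.recOnMul with
    | ih1 x =>
      obtain ⟨x, b⟩ := x
      cases b
      · exact gen_mem x
      · have := star_mem _ (gen_mem x)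
        rwa [star_gen] at this
    | ih2 x y hx hy =>
      have := mul _ _ hx hy
      rwa [mono_mul_mono, mul_one] at this

/-! ### The universal C*-seminorm -/

/-- A seminorm on the free `*`-algebra is admissible if it is a C*-seminorm for which the generators
satisfy the Cuntz–Krieger relations modulo elements of seminorm zero. -/
structure Admissible (p : Seminorm ℂ E.FreeStarAlg) : Prop where
  mul_le : ∀ x y, p (x * y) ≤ p x * p y
  star_mul_self : ∀ x, p (star x * x) = p x * p x
  relations : E.CKRelations (fun x y => p (x - y) = 0)
    (fun v => gen (Sum.inl v)) (fun e => gen (Sum.inr e))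

theorem admissible_zero : Admissible (0 : Seminorm ℂ E.FreeStarAlg) := by
  constructor
  · simp
  · simp
  · constructor <;> simp

theorem seminorm_eq_of_sub {p : Seminorm ℂ E.FreeStarAlg} {x y : E.FreeStarAlg}
    (h : p (x - y) = 0) : p x = p y := by
  have h1 := map_add_le_add p (x - y) y
  have h2 := map_add_le_add p (y - x) x
  rw [sub_add_cancel] at h1 h2
  rw [map_sub_rev p y x] at h2
  linarith

theorem Admissible.gen_le_one {p : Seminorm ℂ E.FreeStarAlg} (hp : Admissible p) (x : V ⊕ W) :
    p (gen x) ≤ 1 := by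
  have key : ∀ v, p (gen (Sum.inl v)) ≤ 1 := fun v => by
    have h1 := hp.star_mul_self (gen (Sum.inl v))
    have h2 := seminorm_eq_of_sub (hp.relations.proj_mul_proj v)
    have h3 := seminorm_eq_of_sub (hp.relations.star_proj v)
    have h4 := hp.mul_le (star (gen (Sum.inl v)) - gen (Sum.inl v)) (gen (Sum.inl v))
    rw [hp.relations.star_proj v, zero_mul, sub_mul] at h4
    have h5 := seminorm_eq_of_sub (le_antisymm h4 (apply_nonneg p _))
    nlinarith
  rcases x with v | e
  · exact key v
  · have h1 := hp.star_mul_self (gen (Sum.inr e))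
    have h2 := seminorm_eq_of_sub (hp.relations.ck1 e)
    have h3 := key (E.rng e)
    nlinarith

theorem Admissible.star_eq {p : Seminorm ℂ E.FreeStarAlg} (hp : Admissible p)
    (x : E.FreeStarAlg) : p (star x) = p x := by
  have key : ∀ y : E.FreeStarAlg, p y ≤ p (star y) := fun y => by
    rcases (apply_nonneg p y).eq_or_lt with h | h
    · rw [← h]; exact apply_nonneg p _
    · refine le_of_mul_le_mul_right ?_ h
      rw [← hp.star_mul_self]
      exact hp.mul_le _ _
  exact le_antisymm (by simpa using key (star x)) (key x)

theorem bddAbove (x : E.FreeStarAlg) :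
    BddAbove (Set.range fun p : {p : Seminorm ℂ E.FreeStarAlg // Admissible p} => p.1 x) := by
  suffices ∃ C, ∀ p : Seminorm ℂ E.FreeStarAlg, Admissible p → p x ≤ C by
    obtain ⟨C, hC⟩ := this
    exact ⟨C, by rintro _ ⟨p, rfl⟩; exact hC p.1 p.2⟩
  induction x using gen_ind with
  | zero => exact ⟨0, fun p _ => by simp⟩
  | add x y hx hy =>
    obtain ⟨C, hC⟩ := hx
    obtain ⟨D, hD⟩ := hy
    exact ⟨C + D, fun p hp => (map_add_le_add p x y).trans (add_le_add (hC p hp) (hD p hp))⟩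
  | mul x y hx hy =>
    obtain ⟨C, hC⟩ := hx
    obtain ⟨D, hD⟩ := hy
    exact ⟨C * D, fun p hp => (hp.mul_le x y).trans (mul_le_mul (hC p hp) (hD p hp)
      (apply_nonneg p y) ((apply_nonneg p x).trans (hC p hp)))⟩
  | smul c x hx =>
    obtain ⟨C, hC⟩ := hx
    exact ⟨‖c‖ * C, fun p hp => by
      rw [map_smul_eq_mul]; exact mul_le_mul_of_nonneg_left (hC p hp) (norm_nonneg c)⟩
  | star_mem x hx =>
    obtain ⟨C, hC⟩ := hx
    exact ⟨C, fun p hp => by rw [hp.star_eq]; exact hC p hp⟩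
  | gen_mem x => exact ⟨1, fun p hp => hp.gen_le_one x⟩

instance : Nonempty {p : Seminorm ℂ E.FreeStarAlg // Admissible p} := ⟨⟨0, admissible_zero⟩⟩

theorem le_iSup {p : Seminorm ℂ E.FreeStarAlg} (hp : Admissible p) (x : E.FreeStarAlg) :
    p x ≤ ⨆ q : {q : Seminorm ℂ E.FreeStarAlg // Admissible q}, q.1 x :=
  le_ciSup (bddAbove x) ⟨p, hp⟩

variable (E) in
/-- The universal C*-seminorm: the supremum of all admissible C*-seminorms. -/
def universalSeminorm : Seminorm ℂ E.FreeStarAlg :=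
  Seminorm.of (fun x => ⨆ p : {p : Seminorm ℂ E.FreeStarAlg // Admissible p}, p.1 x)
    (fun x y => ciSup_le fun p => (map_add_le_add p.1 x y).trans
      (add_le_add (le_iSup p.2 x) (le_iSup p.2 y)))
    (fun c x => by
      simp only [map_smul_eq_mul]
      rw [Real.mul_iSup_of_nonneg (norm_nonneg c)])

theorem universalSeminorm_apply (x : E.FreeStarAlg) : universalSeminorm E x =
    ⨆ p : {p : Seminorm ℂ E.FreeStarAlg // Admissible p}, p.1 x := rfl

theorem admissible_universalSeminorm : Admissible (universalSeminorm E) := by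
  have h0 : ∀ x : E.FreeStarAlg, 
      (∀ p : Seminorm ℂ E.FreeStarAlg, Admissible p → p x = 0) → universalSeminorm E x = 0 := by
    intro x h
    rw [universalSeminorm_apply]
    simp only [fun p : {p : Seminorm ℂ E.FreeStarAlg // Admissible p} => h p.1 p.2, ciSup_const]
  refine ⟨fun x y => ?_, fun x => ?_, ?_⟩
  · exact ciSup_le fun p => (p.2.mul_le x y).trans (mul_le_mul (le_iSup p.2 x) (le_iSup p.2 y)
      (apply_nonneg p.1 y) ((apply_nonneg p.1 x).trans (le_iSup p.2 x)))
  · have hnn : 0 ≤ universalSeminorm E x := apply_nonneg _ x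
    apply le_antisymm
    · refine ciSup_le fun p => ?_
      rw [p.2.star_mul_self]
      exact mul_le_mul (le_iSup p.2 x) (le_iSup p.2 x) (apply_nonneg p.1 x) hnn
    · have : universalSeminorm E x ≤ Real.sqrt (universalSeminorm E (star x * x)) := by
        refine ciSup_le fun p => Real.le_sqrt_of_sq_le ?_
        rw [sq, ← p.2.star_mul_self]
        exact le_iSup p.2 _
      calc _ ≤ Real.sqrt (universalSeminorm E (star x * x)) *
            Real.sqrt (universalSeminorm E (star x * x)) :=
            mul_le_mul this this hnn (Real.sqrt_nonneg _)
        _ = _ := Real.mul_self_sqrt (apply_nonneg _ _)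
  · exact
      { star_proj := fun v => h0 _ fun p hp => hp.relations.star_proj v
        proj_mul_proj := fun v => h0 _ fun p hp => hp.relations.proj_mul_proj v
        orthogonal := fun v w h => h0 _ fun p hp => hp.relations.orthogonal v w h
        partialIsometry := fun e => h0 _ fun p hp => hp.relations.partialIsometry e
        ck1 := fun e => h0 _ fun p hp => hp.relations.ck1 e
        ck2 := fun v t h h' => h0 _ fun p hp => hp.relations.ck2 v t h h' }

instance : SeminormedAddCommGroup E.FreeStarAlg :=
  (universalSeminorm E).toAddGroupSeminorm.toSeminormedAddCommGroup

theorem norm_def (x : E.FreeStarAlg) : ‖x‖ = universalSeminorm E x := rfl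

instance : NonUnitalSeminormedRing E.FreeStarAlg where
  dist_eq := (inferInstance : SeminormedAddCommGroup E.FreeStarAlg).dist_eq
  norm_mul_le := admissible_universalSeminorm.mul_le

instance : NormedSpace ℂ E.FreeStarAlg where
  norm_smul_le c x := (map_smul_eq_mul (universalSeminorm E) c x).le

instance : HasCStarSeminorm E.FreeStarAlg where
  norm_star_mul_self := admissible_universalSeminorm.star_mul_self

end FreeStarAlg

/-! ### The graph C*-algebra -/

/-- The graph C*-algebra of a row-finite graph `E`: the universal C*-algebra generated by a
Cuntz–Krieger `E`-family. -/
def CStar (E : DirectedGraph V W) : Type _ := CStarCompletion E.FreeStarAlg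

namespace CStar

variable (E : DirectedGraph V W)

instance : NonUnitalCStarAlgebra E.CStar :=
  inferInstanceAs (NonUnitalCStarAlgebra (CStarCompletion E.FreeStarAlg))

/-- The generating projections. -/
def P (v : V) : E.CStar := CStarCompletion.coe (FreeStarAlg.gen (Sum.inl v) : E.FreeStarAlg)

/-- The generating partial isometries. -/
def S (e : W) : E.CStar := CStarCompletion.coe (FreeStarAlg.gen (Sum.inr e) : E.FreeStarAlg)

theorem isCKFamily : E.IsCKFamily (P E) (S E) := by
  obtain ⟨c, hc⟩ : ∃ c : E.FreeStarAlg → E.CStar, c = CStarCompletion.coe := ⟨_, rfl⟩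
  have c_add : ∀ x y, c (x + y) = c x + c y := hc ▸ CStarCompletion.coe_add
  have c_sub : ∀ x y, c (x - y) = c x - c y := hc ▸ CStarCompletion.coe_sub
  have c_mul : ∀ x y, c (x * y) = c x * c y := hc ▸ CStarCompletion.coe_mul
  have c_star : ∀ x, c (star x) = star (c x) := hc ▸ CStarCompletion.coe_star
  have c_norm : ∀ x, ‖c x‖ = ‖x‖ := hc ▸ CStarCompletion.norm_coe
  have c_zero : c 0 = 0 := hc ▸ CStarCompletion.coe_zero
  have hP : P E = fun v => c (FreeStarAlg.gen (Sum.inl v)) := by rw [hc]; rfl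
  have hS : S E = fun e => c (FreeStarAlg.gen (Sum.inr e)) := by rw [hc]; rfl
  have h0 : ∀ {x y : E.FreeStarAlg}, FreeStarAlg.universalSeminorm E (x - y) = 0 → c x = c y := by
    intro x y h
    rw [← sub_eq_zero, ← c_sub, ← norm_eq_zero, c_norm]
    exact h
  have c_sum : ∀ (t : Finset W) (f : W → E.FreeStarAlg), c (∑ e ∈ t, f e) = ∑ e ∈ t, c (f e) :=
    fun t f => map_sum (AddMonoidHom.mk' c c_add) f t
  have hr := (FreeStarAlg.admissible_universalSeminorm (E := E)).relations
  rw [hP, hS]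
  exact
    { star_proj := fun v => by rw [← c_star]; exact h0 (hr.star_proj v)
      proj_mul_proj := fun v => by rw [← c_mul]; exact h0 (hr.proj_mul_proj v)
      orthogonal := fun v w h => by rw [← c_mul, ← c_zero]; exact h0 (hr.orthogonal v w h)
      partialIsometry := fun e => by
        rw [← c_star, ← c_mul, ← c_mul]; exact h0 (hr.partialIsometry e)
      ck1 := fun e => by rw [← c_star, ← c_mul]; exact h0 (hr.ck1 e)
      ck2 := fun v t h h' => by
        simp only [← c_star, ← c_mul, ← c_sum]; exact h0 (hr.ck2 v t h h') }

variable {E}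

section lift

variable {B : Type*} [NonUnitalCStarAlgebra B] {P' : V → B} {S' : W → B}

theorem norm_eval_le (h : E.IsCKFamily P' S') (x : E.FreeStarAlg) :
    ‖(FreeStarAlg.eval (Sum.elim P' S') : E.FreeStarAlg →⋆ₙₐ[ℂ] B) x‖ ≤ ‖x‖ := by
  let φ : E.FreeStarAlg →⋆ₙₐ[ℂ] B := FreeStarAlg.eval (Sum.elim P' S')
  have hP : ∀ v, φ (FreeStarAlg.gen (Sum.inl v)) = P' v := fun v => FreeStarAlg.eval_gen _ _
  have hS : ∀ e, φ (FreeStarAlg.gen (Sum.inr e)) = S' e := fun e => FreeStarAlg.eval_gen _ _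
  let p : Seminorm ℂ E.FreeStarAlg := Seminorm.of (fun x => ‖φ x‖)
    (fun x y => by rw [map_add]; exact norm_add_le _ _)
    (fun c x => by rw [map_smul, norm_smul])
  have hp0 : ∀ x y, φ x = φ y → p (x - y) = 0 := fun x y h => by
    change ‖φ (x - y)‖ = 0
    rw [map_sub, h, sub_self, norm_zero]
  have hp : FreeStarAlg.Admissible p :=
    { mul_le := fun x y => by
        change ‖φ (x * y)‖ ≤ ‖φ x‖ * ‖φ y‖
        rw [map_mul]; exact norm_mul_le _ _
      star_mul_self := fun x => by
        change ‖φ (star x * x)‖ = ‖φ x‖ * ‖φ x‖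
        rw [map_mul, map_star]; exact CStarRing.norm_star_mul_self
      relations :=
        { star_proj := fun v => hp0 _ _ (by simp only [map_star, hP, h.star_proj v])
          proj_mul_proj := fun v => hp0 _ _ (by simp only [map_mul, hP, h.proj_mul_proj v])
          orthogonal := fun v w hvw => hp0 _ _ (by
            simp only [map_mul, map_zero, hP, h.orthogonal v w hvw])
          partialIsometry := fun e => hp0 _ _ (by
            simp only [map_mul, map_star, hS, h.partialIsometry e])
          ck1 := fun e => hp0 _ _ (by simp only [map_mul, map_star, hS, hP, h.ck1 e])
          ck2 := fun v t ht ht' => hp0 _ _ (by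
            simp only [map_sum, map_mul, map_star, hS, hP, h.ck2 v t ht ht']) } }
  exact FreeStarAlg.le_iSup hp x

/-- The universal property: a Cuntz–Krieger `E`-family in a C*-algebra `B` induces a
`*`-homomorphism `C*(E) → B`. -/
def lift (P' : V → B) (S' : W → B) (h : E.IsCKFamily P' S') : E.CStar →⋆ₙₐ[ℂ] B :=
  CStarCompletion.extendHom (FreeStarAlg.eval (Sum.elim P' S')) (norm_eval_le h)

@[simp]
theorem lift_P (h : E.IsCKFamily P' S') (v : V) : lift P' S' h (P E v) = P' v :=
  (CStarCompletion.extendHom_coe _ _ _).trans (FreeStarAlg.eval_gen _ _)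

@[simp]
theorem lift_S (h : E.IsCKFamily P' S') (e : W) : lift P' S' h (S E e) = S' e :=
  (CStarCompletion.extendHom_coe _ _ _).trans (FreeStarAlg.eval_gen _ _)

/-- `*`-homomorphisms out of `C*(E)` are determined by their values on the generators. -/
theorem hom_ext {φ ψ : E.CStar →⋆ₙₐ[ℂ] B} (hP : ∀ v, φ (P E v) = ψ (P E v))
    (hS : ∀ e, φ (S E e) = ψ (S E e)) : φ = ψ := by
  have hφ : Continuous φ :=
    (NonUnitalStarAlgHom.instContinuousLinearMapClassComplex (F := E.CStar →⋆ₙₐ[ℂ] B)).map_continuous φ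
  have hψ : Continuous ψ :=
    (NonUnitalStarAlgHom.instContinuousLinearMapClassComplex (F := E.CStar →⋆ₙₐ[ℂ] B)).map_continuous ψ
  let c : E.FreeStarAlg → E.CStar := CStarCompletion.coe
  have c_add : ∀ x y, c (x + y) = c x + c y := CStarCompletion.coe_add
  have c_mul : ∀ x y, c (x * y) = c x * c y := CStarCompletion.coe_mul
  have c_smul : ∀ (z : ℂ) x, c (z • x) = z • c x := CStarCompletion.coe_smul
  have c_star : ∀ x, c (star x) = star (c x) := CStarCompletion.coe_star
  have key : ∀ x, φ (c x) = ψ (c x) := fun x => by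
    induction x using FreeStarAlg.gen_ind with
    | zero => exact (map_zero φ).trans (map_zero ψ).symm
    | add x y hx hy => rw [c_add, map_add, map_add, hx, hy]
    | mul x y hx hy => rw [c_mul, map_mul, map_mul, hx, hy]
    | smul z x hx => rw [c_smul, map_smul, map_smul, hx]
    | star_mem x hx => rw [c_star, map_star, map_star, hx]
    | gen_mem x =>
      rcases x with v | e
      · exact hP v
      · exact hS e
  ext x
  exact CStarCompletion.ind (F := E.FreeStarAlg) (p := fun x => φ x = ψ x) x
    (isClosed_eq hφ hψ) key

end lift

end CStar

end DirectedGraph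

/-! ### Circle actions, fixed points, tensoring with `C(S¹)`, pullbacks -/

section CStarGeneral

variable {A : Type*} [NonUnitalCStarAlgebra A]

/-- The fixed-point subalgebra of a family of `*`-endomorphisms indexed by the circle `U(1)`. -/
def circleFixedPoints (α : Circle → A →⋆ₙₐ[ℂ] A) : NonUnitalStarSubalgebra ℂ A where
  carrier := {x | ∀ z, α z x = x}
  add_mem' hx hy z := by rw [map_add, hx z, hy z]
  zero_mem' z := map_zero _
  mul_mem' hx hy z := by rw [map_mul, hx z, hy z]
  smul_mem' c x hx z := by rw [map_smul, hx z]
  star_mem' hx z := by rw [map_star, hx z]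

theorem mem_circleFixedPoints {α : Circle → A →⋆ₙₐ[ℂ] A} {x : A} :
    x ∈ circleFixedPoints α ↔ ∀ z, α z x = x := Iff.rfl

instance isClosed_circleFixedPoints (α : Circle → A →⋆ₙₐ[ℂ] A) :
    IsClosed (circleFixedPoints α : Set A) := by
  have : (circleFixedPoints α : Set A) = ⋂ z, {x | α z x = x} := by
    ext x; simp [mem_circleFixedPoints]
  rw [this]
  exact isClosed_iInter fun z => isClosed_eq
    ((NonUnitalStarAlgHom.instContinuousLinearMapClassComplex
      (F := A →⋆ₙₐ[ℂ] A)).map_continuous (α z)) continuous_id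

variable {B C : Type*} [NonUnitalCStarAlgebra B] [NonUnitalCStarAlgebra C]

/-- The restriction-corestriction of an equivariant `*`-homomorphism to fixed-point subalgebras. -/
def restrictFixed {α : Circle → A →⋆ₙₐ[ℂ] A} {β : Circle → B →⋆ₙₐ[ℂ] B} (φ : A →⋆ₙₐ[ℂ] B)
    (hφ : ∀ z x, φ (α z x) = β z (φ x)) : circleFixedPoints α →⋆ₙₐ[ℂ] circleFixedPoints β :=
  NonUnitalStarAlgHom.codRestrict
    (φ.comp (NonUnitalStarSubalgebraClass.subtype (circleFixedPoints α))) (circleFixedPoints β)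
    fun x z => by
      change β z (φ x) = φ x
      rw [← hφ, x.2 z]

/-- The elementary tensor `a ⊗ h` in `A ⊗ C(S¹)`, where `A ⊗ C(S¹)` is the C*-algebra `C(S¹, A)` of
continuous `A`-valued functions on the circle. -/
def elemTensor (a : A) (h : C(Circle, ℂ)) : C(Circle, A) where
  toFun z := h z • a

/-- The standard unitary generator `u` of `C(S¹)`. -/
def circleU : C(Circle, ℂ) where
  toFun z := z

theorem elemTensor_mul (a b : A) (h k : C(Circle, ℂ)) :
    elemTensor a h * elemTensor b k = elemTensor (a * b) (h * k) := by
  ext z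
  simp [elemTensor, smul_mul_smul_comm]

theorem elemTensor_star (a : A) (h : C(Circle, ℂ)) :
    star (elemTensor a h) = elemTensor (star a) (star h) := by
  ext z
  simp [elemTensor]

theorem elemTensor_sum {ι : Type*} (t : Finset ι) (a : ι → A) (h : C(Circle, ℂ)) :
    ∑ i ∈ t, elemTensor (a i) h = elemTensor (∑ i ∈ t, a i) h := by
  ext z
  simp [elemTensor, Finset.smul_sum]

theorem elemTensor_zero (h : C(Circle, ℂ)) : elemTensor (0 : A) h = 0 := by
  ext z
  simp [elemTensor]

theorem star_circleU_mul : star circleU * circleU = 1 := by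
  ext z
  change star (z : ℂ) * (z : ℂ) = 1
  simp [← Circle.coe_inv_eq_conj]

theorem circleU_mul_star : circleU * star circleU = 1 := by
  rw [mul_comm, star_circleU_mul]

variable (A) in
/-- The action of `U(1)` on `A ⊗ C(S¹)` by rotation of the circle in the tensor factor `C(S¹)`. -/
def circleRotation (z : Circle) : C(Circle, A) →⋆ₙₐ[ℂ] C(Circle, A) where
  toFun g := g.comp ⟨fun w => z * w, by fun_prop⟩
  map_smul' _ _ := rfl
  map_zero' := rfl
  map_add' _ _ := rfl
  map_mul' _ _ := rfl
  map_star' _ := rfl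

variable (A) in
/-- The identification `(A ⊗ C(S¹))^{U(1)} = A ⊗ 1 ≅ A`, sending `a ⊗ 1` to `a`. -/
def circleRotationFixedEquiv : circleFixedPoints (circleRotation A) ≃⋆ₐ[ℂ] A where
  toFun g := (g : C(Circle, A)) 1
  invFun a := ⟨elemTensor a 1, fun _ => rfl⟩
  left_inv g := by
    ext z
    have h := congrArg (fun k : C(Circle, A) => k 1) (g.2 z)
    change (g : C(Circle, A)) (z * 1) = (g : C(Circle, A)) 1 at h
    rw [mul_one] at h
    simp [elemTensor, h]
  right_inv a := by simp [elemTensor]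
  map_mul' _ _ := rfl
  map_add' _ _ := rfl
  map_star' _ := rfl
  map_smul' _ _ := rfl

variable {D : Type*} [NonUnitalCStarAlgebra D]

/-- The pullback C*-algebra `{(b, c) ∈ B × C | g b = k c}` of `g : B → D` and `k : C → D`. -/
def pullbackAlgebra (g : B →⋆ₙₐ[ℂ] D) (k : C →⋆ₙₐ[ℂ] D) : NonUnitalStarSubalgebra ℂ (B × C) :=
  NonUnitalStarAlgHom.equalizer (g.comp (NonUnitalStarAlgHom.fst ℂ B C))
    (k.comp (NonUnitalStarAlgHom.snd ℂ B C))

/-- A commutative square of C*-algebras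
`A → B`, `A → C`, `B → D`, `C → D` is a pullback diagram if the induced `*`-homomorphism from `A`
to the pullback C*-algebra of `B → D` and `C → D` is an isomorphism. -/
def IsPullbackDiagram (p : A →⋆ₙₐ[ℂ] B) (q : A →⋆ₙₐ[ℂ] C) (g : B →⋆ₙₐ[ℂ] D)
    (k : C →⋆ₙₐ[ℂ] D) : Prop :=
  ∃ h : ∀ a, p.prod q a ∈ pullbackAlgebra g k,
    Function.Bijective (NonUnitalStarAlgHom.codRestrict (p.prod q) (pullbackAlgebra g k) h)

end CStarGeneral

namespace DirectedGraph

variable {V W : Type*}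

namespace CStar

variable (E : DirectedGraph V W)

theorem gauge_family (z : Circle) :
    E.IsCKFamily (P E) (fun e => (z : ℂ) • S E e) := by
  have h := isCKFamily E
  have h1 : (z : ℂ) * star (z : ℂ) = 1 := by
    simp [← Circle.coe_inv_eq_conj]
  have h2 : star (z : ℂ) * (z : ℂ) = 1 := by rw [mul_comm, h1]
  exact
    { star_proj := h.star_proj
      proj_mul_proj := h.proj_mul_proj
      orthogonal := h.orthogonal
      partialIsometry := fun e => by
        rw [star_smul, smul_mul_smul_comm, h1, one_smul, mul_smul_comm, h.partialIsometry e]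
      ck1 := fun e => by rw [star_smul, smul_mul_smul_comm, h2, one_smul, h.ck1 e]
      ck2 := fun v t ht ht' => by
        rw [← h.ck2 v t ht ht']
        exact Finset.sum_congr rfl fun e _ => by
          rw [star_smul, smul_mul_smul_comm, h1, one_smul] }

/-- The gauge action of `U(1)` on `C*(E)`: `P v ↦ P v`, `S e ↦ z S e`. -/
def gauge (z : Circle) : E.CStar →⋆ₙₐ[ℂ] E.CStar :=
  lift (P E) (fun e => (z : ℂ) • S E e) (gauge_family E z)

/-- The fixed-point subalgebra `C*(E)^{U(1)}` of the gauge action. -/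
abbrev gaugeFixed : NonUnitalStarSubalgebra ℂ E.CStar := circleFixedPoints (gauge E)

/-- The inclusion `C*(E)^{U(1)} → C*(E)`. -/
def gaugeFixedIncl : gaugeFixed E →⋆ₙₐ[ℂ] E.CStar :=
  NonUnitalStarSubalgebraClass.subtype (gaugeFixed E)

end CStar

/-! ### Trimmable graphs -/

/-- The graph `E` is `v₀`-trimmable, where `v₀` is a vertex emitting a loop `e₀`. -/
structure IsTrimmable (E : DirectedGraph V W) (v₀ : V) (e₀ : W) : Prop where
  finite_vertices : Finite V
  finite_edges : Finite W
  src_loop : E.src e₀ = v₀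
  rng_loop : E.rng e₀ = v₀
  src_preimage : E.src ⁻¹' {v₀} = {e₀}
  nonempty : (E.rng ⁻¹' {v₀} \ {e₀}).Nonempty
  trim : ∀ v ∈ E.src '' (E.rng ⁻¹' {v₀} \ {e₀}), (E.src ⁻¹' {v} \ E.rng ⁻¹' {v₀}).Nonempty

/-- The subgraph obtained by removing one edge. -/
def deleteEdge (E : DirectedGraph V W) (e₀ : W) : DirectedGraph V {e : W // e ≠ e₀} where
  src e := E.src e
  rng e := E.rng e

/-- The subgraph obtained by removing a vertex and all edges starting or ending in it. -/
def deleteVertex (E : DirectedGraph V W) (v₀ : V) :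
    DirectedGraph {v : V // v ≠ v₀} {e : W // E.src e ≠ v₀ ∧ E.rng e ≠ v₀} where
  src e := ⟨E.src e, e.2.1⟩
  rng e := ⟨E.rng e, e.2.2⟩

section quotient

variable (E : DirectedGraph V W) (v₀ : V)

open Classical in
/-- The projection `P v` of `C*(E'')` for `v ≠ v₀`, and `0` for `v = v₀`. -/
def quotP (v : V) : (E.deleteVertex v₀).CStar :=
  if h : v ≠ v₀ then CStar.P (E.deleteVertex v₀) ⟨v, h⟩ else 0

open Classical in
/-- The partial isometry `S e` of `C*(E'')` for edges `e` of `E''`, and `0` for the other edges. -/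
def quotS (e : W) : (E.deleteVertex v₀).CStar :=
  if h : E.src e ≠ v₀ ∧ E.rng e ≠ v₀ then CStar.S (E.deleteVertex v₀) ⟨e, h⟩ else 0

variable {E v₀}

theorem quotP_of_ne {v : V} (h : v ≠ v₀) :
    E.quotP v₀ v = CStar.P (E.deleteVertex v₀) ⟨v, h⟩ := dif_pos h

theorem quotP_self : E.quotP v₀ v₀ = 0 := dif_neg (by simp)

theorem quotS_of {e : W} (h : E.src e ≠ v₀ ∧ E.rng e ≠ v₀) :
    E.quotS v₀ e = CStar.S (E.deleteVertex v₀) ⟨e, h⟩ := dif_pos h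

theorem quotS_of_not {e : W} (h : ¬ (E.src e ≠ v₀ ∧ E.rng e ≠ v₀)) :
    E.quotS v₀ e = 0 := dif_neg h

open Classical in
theorem IsTrimmable.quot_family {e₀ : W} (h : E.IsTrimmable v₀ e₀) {W' : Type*} (j : W' → W)
    (hj : Function.Injective j) (hr : ∀ e, e ≠ e₀ → e ∈ Set.range j) :
    IsCKFamily ⟨fun e => E.src (j e), fun e => E.rng (j e)⟩
      (E.quotP v₀) (fun e => E.quotS v₀ (j e)) := by
  have hF := CStar.isCKFamily (E.deleteVertex v₀)
  have hsrc : ∀ e, E.src e = v₀ → e = e₀ := fun e he => by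
    have : e ∈ E.src ⁻¹' {v₀} := he
    rwa [h.src_preimage] at this
  refine ⟨fun v => ?_, fun v => ?_, fun v w hvw => ?_, fun e => ?_, fun e => ?_,
    fun v t ht ht' => ?_⟩
  · by_cases hv : v = v₀
    · subst hv; rw [quotP_self, star_zero]
    · rw [quotP_of_ne hv]; exact hF.star_proj _
  · by_cases hv : v = v₀
    · subst hv; rw [quotP_self, mul_zero]
    · rw [quotP_of_ne hv]; exact hF.proj_mul_proj _
  · by_cases hv : v = v₀
    · subst hv; rw [quotP_self, zero_mul]
    · by_cases hw : w = v₀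
      · subst hw; rw [quotP_self, mul_zero]
      · rw [quotP_of_ne hv, quotP_of_ne hw]
        exact hF.orthogonal _ _ fun hh => hvw (congrArg Subtype.val hh)
  · by_cases he : E.src (j e) ≠ v₀ ∧ E.rng (j e) ≠ v₀
    · rw [quotS_of he]; exact hF.partialIsometry _
    · rw [quotS_of_not he, mul_zero]
  · by_cases he : E.src (j e) ≠ v₀ ∧ E.rng (j e) ≠ v₀
    · rw [quotS_of he]
      exact (hF.ck1 _).trans (quotP_of_ne he.2).symm
    · have : E.rng (j e) = v₀ := by
        by_contra hne
        have hs : E.src (j e) = v₀ := by tauto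
        rw [hsrc _ hs] at hne
        exact hne h.rng_loop
      rw [quotS_of_not he, mul_zero]
      change 0 = E.quotP v₀ (E.rng (j e))
      rw [this, quotP_self]
  · change ∀ e, e ∈ t ↔ E.src (j e) = v at ht
    by_cases hv : v = v₀
    · subst hv
      rw [quotP_self]
      refine Finset.sum_eq_zero fun e he => ?_
      rw [quotS_of_not (fun hh => hh.1 ((ht e).1 he)), zero_mul]
    · have hs : ∀ e, e ∈ t.image j ↔ E.src e = v := fun e => by
        rw [Finset.mem_image]
        constructor
        · rintro ⟨x, hx, rfl⟩; exact (ht x).1 hx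
        · intro he
          obtain ⟨x, rfl⟩ := hr e (by rintro rfl; exact hv (he.symm.trans h.src_loop))
          exact ⟨x, (ht x).2 he, rfl⟩
      have hsum : ∑ e ∈ t, E.quotS v₀ (j e) * star (E.quotS v₀ (j e)) =
          ∑ e ∈ (t.image j).subtype (fun e => E.src e ≠ v₀ ∧ E.rng e ≠ v₀),
            CStar.S (E.deleteVertex v₀) e * star (CStar.S (E.deleteVertex v₀) e) := by
        rw [← Finset.sum_image (f := fun e => E.quotS v₀ e * star (E.quotS v₀ e))
          (fun x _ y _ hxy => hj hxy)]
        rw [← Finset.sum_filter_of_ne (p := fun e => E.src e ≠ v₀ ∧ E.rng e ≠ v₀)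
          (fun x _ hx => by
            by_contra hh
            rw [quotS_of_not hh, zero_mul] at hx
            exact hx rfl), ← Finset.sum_subtype_eq_sum_filter]
        exact Finset.sum_congr rfl fun x _ => by rw [quotS_of x.2]
      rw [hsum, quotP_of_ne hv]
      refine hF.ck2 ⟨v, hv⟩ _ (fun e => ?_) ?_
      · rw [Finset.mem_subtype, hs]
        exact ⟨fun hh => Subtype.ext hh, fun hh => congrArg Subtype.val hh⟩
      · obtain ⟨x, hx⟩ := ht'
        have hx' := (ht x).1 hx
        by_cases hrx : E.rng (j x) = v₀
        · obtain ⟨y, hy, hy'⟩ := h.trim v ⟨j x, ⟨hrx, by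
            rintro (hh : j x = e₀)
            rw [hh, h.src_loop] at hx'
            exact hv hx'.symm⟩, hx'⟩
          exact ⟨⟨y, ⟨fun hh => hv (hy.symm.trans hh), hy'⟩⟩,
            Finset.mem_subtype.2 ((hs y).2 hy)⟩
        · exact ⟨⟨j x, ⟨fun hh => hv (hx'.symm.trans hh), hrx⟩⟩,
            Finset.mem_subtype.2 ((hs _).2 hx')⟩

end quotient

namespace IsTrimmable

variable {E : DirectedGraph V W} {v₀ : V} {e₀ : W}

theorem pi₁_family (h : E.IsTrimmable v₀ e₀) : E.IsCKFamily (E.quotP v₀) (E.quotS v₀) :=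
  h.quot_family id Function.injective_id fun e _ => ⟨e, rfl⟩

theorem pi₂_family (h : E.IsTrimmable v₀ e₀) :
    (E.deleteEdge e₀).IsCKFamily (E.quotP v₀) (fun e => E.quotS v₀ e.1) :=
  h.quot_family Subtype.val Subtype.val_injective fun e he => ⟨⟨e, he⟩, rfl⟩

/-- The quotient map `π₁ : C*(E) → C*(E'')`. -/
def pi₁ (h : E.IsTrimmable v₀ e₀) : E.CStar →⋆ₙₐ[ℂ] (E.deleteVertex v₀).CStar :=
  CStar.lift (E.quotP v₀) (E.quotS v₀) h.pi₁_family

/-- The quotient map `π₂ : C*(E') → C*(E'')`. -/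
def pi₂ (h : E.IsTrimmable v₀ e₀) : (E.deleteEdge e₀).CStar →⋆ₙₐ[ℂ] (E.deleteVertex v₀).CStar :=
  CStar.lift (E.quotP v₀) (fun e => E.quotS v₀ e.1) h.pi₂_family

theorem pi₁_gauge (h : E.IsTrimmable v₀ e₀) (z : Circle) (x : E.CStar) :
    h.pi₁ (CStar.gauge E z x) = CStar.gauge (E.deleteVertex v₀) z (h.pi₁ x) := by
  have : h.pi₁.comp (CStar.gauge E z) = (CStar.gauge (E.deleteVertex v₀) z).comp h.pi₁ := by
    refine CStar.hom_ext (fun v => ?_) fun e => ?_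
    · simp only [NonUnitalStarAlgHom.comp_apply, pi₁, CStar.gauge, CStar.lift_P]
      by_cases hv : v = v₀
      · subst hv; rw [quotP_self, map_zero]
      · rw [quotP_of_ne hv, CStar.lift_P]
    · simp only [NonUnitalStarAlgHom.comp_apply, pi₁, CStar.gauge, CStar.lift_S, map_smul]
      by_cases he : E.src e ≠ v₀ ∧ E.rng e ≠ v₀
      · rw [quotS_of he, CStar.lift_S]
      · rw [quotS_of_not he, map_zero, smul_zero]
  exact DFunLike.congr_fun this x

variable (E v₀ e₀) in
open Classical in
/-- The images `S e ⊗ u`, for `e ≠ e₀`, and `P v₀ ⊗ u`, for `e = e₀`, in `C*(E') ⊗ C(S¹)`. -/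
def fS (e : W) : C(Circle, (E.deleteEdge e₀).CStar) :=
  if h : e ≠ e₀ then elemTensor (CStar.S (E.deleteEdge e₀) ⟨e, h⟩) circleU
  else elemTensor (CStar.P (E.deleteEdge e₀) v₀) circleU

theorem fS_of_ne {e : W} (h : e ≠ e₀) :
    fS E v₀ e₀ e = elemTensor (CStar.S (E.deleteEdge e₀) ⟨e, h⟩) circleU := dif_pos h

theorem fS_self : fS E v₀ e₀ e₀ = elemTensor (CStar.P (E.deleteEdge e₀) v₀) circleU :=
  dif_neg (by simp)

open Classical in
theorem f_family (h : E.IsTrimmable v₀ e₀) :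
    E.IsCKFamily (fun v => elemTensor (CStar.P (E.deleteEdge e₀) v) 1) (fS E v₀ e₀) := by
  have hF := CStar.isCKFamily (E.deleteEdge e₀)
  refine ⟨fun v => ?_, fun v => ?_, fun v w hvw => ?_, fun e => ?_, fun e => ?_,
    fun v t ht ht' => ?_⟩
  · rw [elemTensor_star, hF.star_proj, star_one]
  · rw [elemTensor_mul, hF.proj_mul_proj, one_mul]
  · rw [elemTensor_mul, hF.orthogonal v w hvw, elemTensor_zero]
  · by_cases he : e = e₀
    · subst he
      rw [fS_self, elemTensor_star, elemTensor_mul, elemTensor_mul, hF.star_proj,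
        hF.proj_mul_proj, hF.proj_mul_proj, circleU_mul_star, one_mul]
    · rw [fS_of_ne he, elemTensor_star, elemTensor_mul, elemTensor_mul, hF.partialIsometry,
        circleU_mul_star, one_mul]
  · by_cases he : e = e₀
    · subst he
      rw [fS_self, elemTensor_star, elemTensor_mul, hF.star_proj, hF.proj_mul_proj,
        star_circleU_mul, h.rng_loop]
    · rw [fS_of_ne he, elemTensor_star, elemTensor_mul, hF.ck1, star_circleU_mul]
      rfl
  · by_cases hv : v = v₀
    · subst hv
      have : t = {e₀} := by
        ext e
        rw [ht, Finset.mem_singleton]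
        have := congrArg (e ∈ ·) h.src_preimage
        simpa using this
      rw [this, Finset.sum_singleton, fS_self, elemTensor_star, elemTensor_mul, hF.star_proj,
        hF.proj_mul_proj, circleU_mul_star]
    · have hne : ∀ e ∈ t, e ≠ e₀ := by
        rintro e he rfl
        exact hv (((ht e).1 he).symm.trans h.src_loop)
      have hsum : ∑ e ∈ t, fS E v₀ e₀ e * star (fS E v₀ e₀ e) =
          ∑ e ∈ t.subtype (· ≠ e₀), elemTensor (CStar.S (E.deleteEdge e₀) e *
            star (CStar.S (E.deleteEdge e₀) e)) 1 := by
        rw [← Finset.sum_subtype_of_mem _ hne]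
        exact Finset.sum_congr rfl fun e _ => by
          rw [fS_of_ne e.2, elemTensor_star, elemTensor_mul, circleU_mul_star]
      rw [hsum, elemTensor_sum, hF.ck2 v]
      · intro e
        rw [Finset.mem_subtype, ht]
        rfl
      · obtain ⟨x, hx⟩ := ht'
        exact ⟨⟨x, hne x hx⟩, Finset.mem_subtype.2 hx⟩

/-- The `*`-homomorphism `f : C*(E) → C*(E') ⊗ C(S¹)`. -/
def f (h : E.IsTrimmable v₀ e₀) : E.CStar →⋆ₙₐ[ℂ] C(Circle, (E.deleteEdge e₀).CStar) :=
  CStar.lift (fun v => elemTensor (CStar.P (E.deleteEdge e₀) v) 1) (fS E v₀ e₀) h.f_family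

theorem f_gauge (h : E.IsTrimmable v₀ e₀) (z : Circle) (x : E.CStar) :
    h.f (CStar.gauge E z x) = circleRotation (E.deleteEdge e₀).CStar z (h.f x) := by
  have : h.f.comp (CStar.gauge E z) = (circleRotation (E.deleteEdge e₀).CStar z).comp h.f := by
    refine CStar.hom_ext (fun v => ?_) fun e => ?_
    · simp only [NonUnitalStarAlgHom.comp_apply, f, CStar.gauge, CStar.lift_P]
      rfl
    · simp only [NonUnitalStarAlgHom.comp_apply, f, CStar.gauge, CStar.lift_S, map_smul]
      by_cases he : e = e₀
      · subst he
        rw [fS_self]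
        ext w
        exact (mul_smul (z : ℂ) (w : ℂ) _).symm
      · rw [fS_of_ne he]
        ext w
        exact (mul_smul (z : ℂ) (w : ℂ) _).symm
  exact DFunLike.congr_fun this x

/-- The restriction-corestriction `C*(E)^{U(1)} → C*(E'')^{U(1)}` of `π₁`. -/
def pi₁Fixed (h : E.IsTrimmable v₀ e₀) :
    CStar.gaugeFixed E →⋆ₙₐ[ℂ] CStar.gaugeFixed (E.deleteVertex v₀) :=
  restrictFixed h.pi₁ h.pi₁_gauge

/-- The restriction-corestriction `C*(E)^{U(1)} → (C*(E') ⊗ C(S¹))^{U(1)} ≅ C*(E')` of `f`. -/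
def fFixed (h : E.IsTrimmable v₀ e₀) : CStar.gaugeFixed E →⋆ₙₐ[ℂ] (E.deleteEdge e₀).CStar :=
  (circleRotationFixedEquiv (E.deleteEdge e₀).CStar : _ →⋆ₙₐ[ℂ] _).comp (restrictFixed h.f h.f_gauge)

end IsTrimmable

end DirectedGraph

end

/-!
Let `g : C*(E) → C*(E')` be `f` followed by evaluation at `1 ∈ S¹` (`fEval`); it sends the loop
`S e₀` to `P v₀` and every other generator to the generator of the same name. On gauge-invariant
elements `g` is the map `fFixed` of the square, and `π₂ ∘ g = π₁` already on all of `C*(E)`, by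
comparing generators. So the square commutes, and it remains to compare the kernels of `π₁` and `π₂`.

Both kernels are treated at once. Consider a Cuntz–Krieger `E`-family `P`, `S` generating a
C*-algebra `A`; the cases needed are the universal family in `C*(E)` and its image under `g`, which
generates `C*(E')`. For a path `μ` that ends in `v₀` and avoids `e₀` put
`t μ = S μ * (star (S e₀)) ^ |μ|` (`pathT`). Then `star (t μ) * t ν` is `P v₀` if `μ = ν` and `0`
otherwise, so that the `t μ * star (t ν)` are matrix units. Together with the powers of the loop,
which is a unitary of the corner at `P v₀`, they span the closed ideal generated by `P v₀`
(`loopIdeal`). The quotient norm of `A` modulo this ideal is a C*-norm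
(`Submodule.IsProjIdeal.norm_mk_star_mul_self`, where finite sums of the projections
`t μ * star (t μ)` serve as approximate unit) and the images of the generators form a
Cuntz–Krieger family for `E''`. By universality the map `A → C*(E'')` is isometric modulo the ideal
(`norm_mk_le_norm_map`); hence its kernel is the ideal, and it is surjective.

Averaging over the gauge action shows that the gauge-invariant part of `ker π₁` is the closed span
of the matrix units (`mem_matrixUnitSpan`), and that gauge-invariant elements lift along `π₁` to
gauge-invariant elements. In `C*(E')` the loop is replaced by `P v₀`, so `ker π₂` is the closed span
of the matrix units `g (t μ) * star (g (t ν))` (`loopIdeal_fEval_le`). A homomorphism between matrix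
algebras that is not zero is isometric, so `g` maps the gauge-invariant part of `ker π₁`
isometrically onto `ker π₂` (`norm_map_of_mem_matrixUnitSpan`,
`exists_map_eq_of_mem_matrixUnitSpan`), provided that `P v₀ ≠ 0` in `C*(E')`; this is seen in the
representation on `ℓ²` of the paths ending in the sink `v₀` (`P_deleteEdge_ne_zero`). The theorem
follows by a diagram chase.
-/

noncomputable section

/-! ### Projections and quotient norms in C*-algebras -/

section CStarLemmas

variable {A : Type*} [NonUnitalCStarAlgebra A]

theorem eq_zero_of_sum_star_mul_self {ι : Type*} {t : Finset ι} {x : ι → A}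
    (h : ∑ i ∈ t, star (x i) * x i = 0) {i : ι} (hi : i ∈ t) : x i = 0 := by
  let _ := CStarAlgebra.spectralOrder A
  let _ := CStarAlgebra.spectralOrderedRing A
  have := (Finset.sum_eq_zero_iff_of_nonneg fun j _ => star_mul_self_nonneg (x j)).1 h i hi
  exact CStarRing.star_mul_self_eq_zero_iff _ |>.1 this

/-- Projections that add up to a projection are mutually orthogonal. -/
theorem IsStarProjection.mul_eq_zero_of_sum {ι : Type*} {t : Finset ι} {p : ι → A} {q : A}
    (hp : ∀ i ∈ t, IsStarProjection (p i)) (hq : IsStarProjection q) (h : ∑ i ∈ t, p i = q)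
    {i j : ι} (hi : i ∈ t) (hj : j ∈ t) (hij : i ≠ j) : p j * p i = 0 := by
  classical
  -- the sum of the positive elements `(1 - q) * p k * (1 - q)` is `(1 - q) * q * (1 - q) = 0`
  have hpq : ∀ k ∈ t, p k * q = p k := by
    intro k hk
    refine (sub_eq_zero.1 (eq_zero_of_sum_star_mul_self (x := fun k => p k - p k * q) (t := t)
      ?_ hk)).symm
    have : ∀ k ∈ t, star (p k - p k * q) * (p k - p k * q) =
        p k - q * p k - (p k * q - q * (p k * q)) := by
      intro k hk
      have h1 := (hp k hk).isSelfAdjoint.star_eq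
      have h2 := (hp k hk).isIdempotentElem.eq
      rw [star_sub, star_mul, h1, hq.isSelfAdjoint.star_eq]
      simp only [sub_mul, mul_sub, ← mul_assoc, h2]
      simp only [mul_assoc q, h2]
    rw [Finset.sum_congr rfl this]
    simp only [Finset.sum_sub_distrib, ← Finset.sum_mul, ← Finset.mul_sum, h,
      hq.isIdempotentElem.eq, sub_self]
  -- compressing `∑ k, p k = q` by `p i` leaves a vanishing sum of positive elements
  have h3 : ∑ k ∈ t.erase i, star (p k * p i) * (p k * p i) = 0 := by
    have h4 : p i * (∑ k ∈ t, p k) * p i = p i := by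
      rw [h, hpq i hi, (hp i hi).isIdempotentElem.eq]
    rw [← Finset.add_sum_erase _ _ hi, mul_add, add_mul, (hp i hi).isIdempotentElem.eq,
      (hp i hi).isIdempotentElem.eq, add_eq_left, Finset.mul_sum, Finset.sum_mul] at h4
    rw [← h4]
    refine Finset.sum_congr rfl fun k hk => ?_
    have hk' := hp k (Finset.mem_of_mem_erase hk)
    rw [star_mul, hk'.isSelfAdjoint.star_eq, (hp i hi).isSelfAdjoint.star_eq]
    rw [mul_assoc, ← mul_assoc (p k), hk'.isIdempotentElem.eq, mul_assoc]
  exact eq_zero_of_sum_star_mul_self h3 (Finset.mem_erase.2 ⟨hij.symm, hj⟩)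

theorem IsStarProjection.norm_sub_mul_le {q : A} (hq : IsStarProjection q) (x : A) :
    ‖x - x * q‖ ≤ ‖x‖ := by
  have h1 : IsStarProjection (1 - (q : Unitization ℂ A)) := by
    refine IsStarProjection.one_sub ⟨?_, ?_⟩
    · rw [IsIdempotentElem, ← Unitization.inr_mul, hq.isIdempotentElem.eq]
    · rw [IsSelfAdjoint, ← Unitization.inr_star, hq.isSelfAdjoint.star_eq]
  have h2 : ((x - x * q : A) : Unitization ℂ A) = x * (1 - q) := by
    rw [Unitization.inr_sub, Unitization.inr_mul, mul_sub, mul_one]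
  rw [← Unitization.norm_inr (𝕜 := ℂ), h2]
  refine (norm_mul_le _ _).trans ?_
  rw [Unitization.norm_inr]
  exact mul_le_of_le_one_right (norm_nonneg _) h1.norm_le

theorem IsStarProjection.norm_sub_mul_le' {q : A} (hq : IsStarProjection q) (x : A) :
    ‖x - q * x‖ ≤ ‖x‖ := by
  have := hq.norm_sub_mul_le (star x)
  rwa [← norm_star, star_sub, star_mul, star_star, hq.isSelfAdjoint.star_eq, norm_star] at this

/-- A two-sided ideal of a C*-algebra which has an approximate unit consisting of projections. If it
is closed, it is automatically self-adjoint, see `Submodule.IsProjIdeal.star_mem`. -/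
structure Submodule.IsProjIdeal (J : Submodule ℂ A) : Prop where
  mul_left : ∀ a, ∀ x ∈ J, a * x ∈ J
  mul_right : ∀ a, ∀ x ∈ J, x * a ∈ J
  approx : ∀ x ∈ J, ∀ ε > 0, ∃ q ∈ J, IsStarProjection q ∧ ‖x - x * q‖ < ε

namespace Submodule.IsProjIdeal

variable {J : Submodule ℂ A}

theorem norm_mk_mul_le (hJ : J.IsProjIdeal) (a b : A) :
    ‖J.mkQ (a * b)‖ ≤ ‖J.mkQ a‖ * ‖J.mkQ b‖ := by
  have key : ∀ x y : A, J.mkQ x = J.mkQ a → J.mkQ y = J.mkQ b → ‖J.mkQ (a * b)‖ ≤ ‖x‖ * ‖y‖ := by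
    intro x y hx hy
    have : J.mkQ (a * b) = J.mkQ (x * y) := by
      simp only [Submodule.mkQ_apply, Submodule.Quotient.eq] at hx hy ⊢
      have h1 := J.add_mem (hJ.mul_right b _ hx) (hJ.mul_left x _ hy)
      have h2 : a * b - x * y = -((x - a) * b + x * (y - b)) := by noncomm_ring
      rw [h2]
      exact J.neg_mem h1
    rw [this]
    exact (Submodule.Quotient.norm_mk_le _ _).trans (norm_mul_le _ _)
  have hlim : Filter.Tendsto (fun δ : ℝ => (‖J.mkQ a‖ + δ) * (‖J.mkQ b‖ + δ))
      (nhdsWithin 0 (Set.Ioi 0)) (nhds ((‖J.mkQ a‖ + 0) * (‖J.mkQ b‖ + 0))) :=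
    (Continuous.tendsto (by fun_prop) 0).mono_left nhdsWithin_le_nhds
  rw [add_zero, add_zero] at hlim
  refine ge_of_tendsto hlim ?_
  filter_upwards [self_mem_nhdsWithin] with δ hδ
  obtain ⟨x, hx, hx'⟩ := Submodule.Quotient.norm_mk_lt (J.mkQ a) hδ
  obtain ⟨y, hy, hy'⟩ := Submodule.Quotient.norm_mk_lt (J.mkQ b) hδ
  exact (key x y hx hy).trans
    (mul_le_mul hx'.le hy'.le (norm_nonneg _) ((norm_nonneg _).trans hx'.le))

/-- A closed ideal with an approximate unit of projections `q` is self-adjoint, since `star x` is the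
limit of the elements `q * star x`. -/
theorem star_mem (hJ : J.IsProjIdeal) (hJc : IsClosed (J : Set A)) {x : A} (hx : x ∈ J) :
    star x ∈ J := by
  refine hJc.closure_subset (Metric.mem_closure_iff.2 fun ε hε => ?_)
  obtain ⟨q, hq, hq', h⟩ := hJ.approx x hx ε hε
  refine ⟨q * star x, hJ.mul_right _ _ hq, ?_⟩
  rwa [dist_eq_norm, ← norm_star, star_sub, star_star, star_mul, star_star,
    hq'.isSelfAdjoint.star_eq]

/-- The quotient norm modulo a closed ideal satisfies the C*-identity. -/
theorem norm_mk_star_mul_self (hJ : J.IsProjIdeal) (hJc : IsClosed (J : Set A)) (a : A) :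
    ‖J.mkQ (star a * a)‖ = ‖J.mkQ a‖ * ‖J.mkQ a‖ := by
  have hs : ∀ a : A, ‖J.mkQ (star a)‖ ≤ ‖J.mkQ a‖ := by
    intro a
    refine le_of_forall_pos_le_add fun ε hε => ?_
    obtain ⟨x, hx, hx'⟩ := Submodule.Quotient.norm_mk_lt (J.mkQ a) hε
    have : J.mkQ (star a) = J.mkQ (star x) := by
      simp only [Submodule.mkQ_apply] at hx ⊢
      rw [Submodule.Quotient.eq] at hx ⊢
      rw [← star_sub, ← neg_sub, star_neg]
      exact J.neg_mem (hJ.star_mem hJc hx)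
    rw [this]
    refine (Submodule.Quotient.norm_mk_le _ _).trans ?_
    rw [norm_star]
    exact hx'.le
  refine le_antisymm ((hJ.norm_mk_mul_le _ _).trans
    (mul_le_mul_of_nonneg_right (hs a) (norm_nonneg _))) ?_
  refine le_of_forall_pos_le_add fun ε hε => ?_
  obtain ⟨x, hx, hx'⟩ := Submodule.Quotient.norm_mk_lt (J.mkQ (star a * a)) (half_pos hε)
  simp only [Submodule.mkQ_apply] at hx
  rw [Submodule.Quotient.eq] at hx
  obtain ⟨q, hq, hq', h⟩ := hJ.approx _ hx (ε / 2) (half_pos hε)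
  have h1 : ‖J.mkQ a‖ ≤ ‖a - a * q‖ := by
    have : J.mkQ a = J.mkQ (a - a * q) := by
      rw [map_sub, eq_comm, sub_eq_self]
      exact (Submodule.Quotient.mk_eq_zero _).2 (hJ.mul_left _ _ hq)
    rw [this]
    exact Submodule.Quotient.norm_mk_le _ _
  -- compress `star a * a` by the projection `1 - q`, which almost annihilates `x - star a * a`
  have h2 : star (a - a * q) * (a - a * q) =
      (x - x * q - q * (x - x * q)) - ((x - star a * a) - (x - star a * a) * q -
        q * ((x - star a * a) - (x - star a * a) * q)) := by
    rw [star_sub, star_mul, hq'.isSelfAdjoint.star_eq]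
    noncomm_ring
  calc ‖J.mkQ a‖ * ‖J.mkQ a‖ ≤ ‖a - a * q‖ * ‖a - a * q‖ :=
        mul_le_mul h1 h1 (norm_nonneg _) (norm_nonneg _)
    _ = ‖star (a - a * q) * (a - a * q)‖ := (CStarRing.norm_star_mul_self).symm
    _ ≤ ‖x‖ + ε / 2 := by
      rw [h2]
      refine (norm_sub_le _ _).trans (add_le_add ?_ ?_)
      · exact (hq'.norm_sub_mul_le' _).trans (hq'.norm_sub_mul_le _)
      · exact (hq'.norm_sub_mul_le' _).trans h.le
    _ ≤ _ := by linarith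

end Submodule.IsProjIdeal

end CStarLemmas

/-! ### Relations in a Cuntz–Krieger family -/

namespace DirectedGraph

variable {V W : Type*} {A : Type*} [NonUnitalCStarAlgebra A]

namespace CKRelations

variable {E : DirectedGraph V W} {P : V → A} {S : W → A}

theorem isStarProjection (hF : E.IsCKFamily P S) (v : V) : IsStarProjection (P v) :=
  ⟨hF.proj_mul_proj v, hF.star_proj v⟩

theorem S_mul_P (hF : E.IsCKFamily P S) (e : W) : S e * P (E.rng e) = S e := by
  rw [← hF.ck1, ← mul_assoc, hF.partialIsometry]

/-- The ranges of the partial isometries attached to the edges emitted by one vertex are orthogonal,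
because their range projections add up to a projection. -/
theorem star_S_mul_S_of_ne_of_src_eq [Finite W] (hF : E.IsCKFamily P S) {e f : W} (hef : e ≠ f)
    (h : E.src e = E.src f) : star (S e) * S f = 0 := by
  classical
  have := Fintype.ofFinite W
  have hp : ∀ g, IsStarProjection (S g * star (S g)) := fun g =>
    ⟨by rw [IsIdempotentElem, ← mul_assoc, hF.partialIsometry],
      by rw [IsSelfAdjoint, star_mul, star_star]⟩
  have h1 := IsStarProjection.mul_eq_zero_of_sum (fun g _ => hp g) (hF.isStarProjection _)
    (hF.ck2 (E.src f) {g | E.src g = E.src f} (by simp) ⟨f, by simp⟩)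
    (i := f) (j := e) (by simp) (by simpa using h) hef.symm
  have h2 : star (S e) * S f = star (S e) * (S e * star (S e) * (S f * star (S f))) * S f := by
    have h3 := congrArg star (hF.partialIsometry e)
    rw [star_mul, star_mul, star_star] at h3
    calc star (S e) * S f = star (S e) * (S e * star (S e)) * (S f * star (S f) * S f) := by
          rw [h3, hF.partialIsometry]
      _ = _ := by simp only [mul_assoc]
  rw [h2, h1, mul_zero, zero_mul]

theorem P_src_mul_S [Finite W] (hF : E.IsCKFamily P S) (e : W) : P (E.src e) * S e = S e := by
  classical
  have := Fintype.ofFinite W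
  have h1 := hF.ck2 (E.src e) {g | E.src g = E.src e} (by simp) ⟨e, by simp⟩
  rw [← h1, Finset.sum_mul, Finset.sum_eq_single_of_mem e (by simp), hF.partialIsometry]
  intro f hf hfe
  rw [mul_assoc, hF.star_S_mul_S_of_ne_of_src_eq hfe (by simpa using hf), mul_zero]

theorem P_mul_S_of_ne [Finite W] (hF : E.IsCKFamily P S) {v : V} {e : W} (h : v ≠ E.src e) :
    P v * S e = 0 := by
  rw [← hF.P_src_mul_S, ← mul_assoc, hF.orthogonal _ _ h, zero_mul]

theorem star_S_mul_S_of_ne [Finite W] (hF : E.IsCKFamily P S) {e f : W} (hef : e ≠ f) :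
    star (S e) * S f = 0 := by
  by_cases h : E.src e = E.src f
  · exact hF.star_S_mul_S_of_ne_of_src_eq hef h
  · rw [← hF.P_src_mul_S e, star_mul, hF.star_proj, mul_assoc, hF.P_mul_S_of_ne h, mul_zero]

end CKRelations

theorem IsTrimmable.src_eq_iff {E : DirectedGraph V W} {v₀ : V} {e₀ : W} (h : E.IsTrimmable v₀ e₀)
    {e : W} : E.src e = v₀ ↔ e = e₀ :=
  Set.ext_iff.1 h.src_preimage e

/-! ### Integer powers of the loop -/

/-- For a unitary `s` of the corner with unit `p`, the powers `s ^ k` taken in that corner: negative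
powers are powers of `star s`, and the power with exponent `0` is `p`. -/
def loopPow (p s : A) : ℤ → A
  | .ofNat n => (s * ·)^[n] p
  | .negSucc n => (star s * ·)^[n + 1] p

section loopPow

variable {p s : A}

theorem loopPow_zero : loopPow p s 0 = p := rfl

theorem proj_mul_loopPow (hp : p * p = p) (h1 : s * star s = p) (h2 : star s * s = p) (k : ℤ) :
    p * loopPow p s k = loopPow p s k := by
  have h3 : p * s = s := by
    have : star (s - p * s) * (s - p * s) = 0 := by
      have hps : star p = p := by rw [← h1, star_mul, star_star]
      rw [star_sub, star_mul, hps, sub_mul, mul_sub, mul_sub]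
      have : star s * p * (p * s) = star s * (p * s) := by
        rw [mul_assoc, ← mul_assoc p, hp]
      rw [this, mul_assoc (star s) p s, sub_self, sub_zero, h2, ← mul_assoc, ← h1, ← mul_assoc, h2,
        h1, mul_assoc, h2, hp, sub_self]
    exact (sub_eq_zero.1 (CStarRing.star_mul_self_eq_zero_iff _ |>.1 this)).symm
  have h4 : p * star s = star s := by
    rw [← h2, mul_assoc, h1]
    have := congrArg star h3
    rwa [star_mul, ← h1, star_mul, star_star, h1] at this
  rcases k with (_ | n) | n
  · exact hp
  · change p * (s * ·)^[n + 1] p = (s * ·)^[n + 1] p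
    rw [Function.iterate_succ_apply', ← mul_assoc, h3]
  · change p * (star s * ·)^[n + 1] p = (star s * ·)^[n + 1] p
    rw [Function.iterate_succ_apply', ← mul_assoc, h4]

variable (hp : p * p = p) (h1 : s * star s = p) (h2 : star s * s = p)
include hp h1 h2

theorem mul_loopPow (k : ℤ) : s * loopPow p s k = loopPow p s (k + 1) := by
  rcases k with n | (_ | n)
  · exact (Function.iterate_succ_apply' (s * ·) n p).symm
  · change s * (star s * p) = p
    rw [← mul_assoc, h1, hp]
  · have : loopPow p s (Int.negSucc (n + 1)) = star s * loopPow p s (Int.negSucc n) :=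
      Function.iterate_succ_apply' (star s * ·) (n + 1) p
    rw [this, ← mul_assoc, h1, proj_mul_loopPow hp h1 h2]
    congr 1

theorem star_mul_loopPow (k : ℤ) : star s * loopPow p s k = loopPow p s (k - 1) := by
  have := mul_loopPow hp h1 h2 (k - 1)
  rw [sub_add_cancel] at this
  rw [← this, ← mul_assoc, h2, proj_mul_loopPow hp h1 h2]

theorem loopPow_mul_comm (k : ℤ) : loopPow p s k * s = s * loopPow p s k := by
  induction k using Int.induction_on with
  | zero =>
    rw [loopPow_zero]
    nth_rw 1 [← h1]
    rw [mul_assoc, h2]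
  | succ k ih => rw [← mul_loopPow hp h1 h2, mul_assoc, ih]
  | pred k ih =>
    rw [← star_mul_loopPow hp h1 h2, mul_assoc, ih, ← mul_assoc, ← mul_assoc, h1, h2]

theorem loopPow_mul_star_comm (k : ℤ) : loopPow p s k * star s = star s * loopPow p s k := by
  induction k using Int.induction_on with
  | zero =>
    rw [loopPow_zero]
    nth_rw 1 [← h2]
    rw [mul_assoc, h1]
  | succ k ih =>
    rw [← mul_loopPow hp h1 h2, mul_assoc, ih, ← mul_assoc, ← mul_assoc, h1, h2]
  | pred k ih => rw [← star_mul_loopPow hp h1 h2, mul_assoc, ih]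

theorem star_loopPow (k : ℤ) : star (loopPow p s k) = loopPow p s (-k) := by
  induction k using Int.induction_on with
  | zero => rw [neg_zero, loopPow_zero, ← h1, star_mul, star_star]
  | succ k ih =>
    rw [← mul_loopPow hp h1 h2, ← loopPow_mul_comm hp h1 h2, star_mul, ih,
      star_mul_loopPow hp h1 h2, neg_add, sub_eq_add_neg]
  | pred k ih =>
    rw [← star_mul_loopPow hp h1 h2, ← loopPow_mul_star_comm hp h1 h2, star_mul, ih, star_star,
      mul_loopPow hp h1 h2]
    congr 1
    ring

end loopPow
end DirectedGraph

/-! ### Paths ending in the distinguished vertex -/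

namespace DirectedGraph

variable {V W : Type*}

/-- The first vertex of a path that ends in `v₀`, given by its list of edges. -/
def pathStart (E : DirectedGraph V W) (v₀ : V) : List W → V
  | [] => v₀
  | e :: _ => E.src e

/-- The list of edges is a path that ends in `v₀` and does not contain the loop `e₀`. -/
def IsPathTo (E : DirectedGraph V W) (v₀ : V) (e₀ : W) : List W → Prop
  | [] => True
  | e :: l => e ≠ e₀ ∧ E.rng e = E.pathStart v₀ l ∧ E.IsPathTo v₀ e₀ l

/-- The paths that end in `v₀` and do not contain the loop `e₀`. -/
abbrev PathTo (E : DirectedGraph V W) (v₀ : V) (e₀ : W) : Type _ :=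
  {l : List W // E.IsPathTo v₀ e₀ l}

/-- The partial isometry `S μ * (star (S e₀)) ^ |μ|` attached to a path `μ` that ends in `v₀`.
It has gauge degree `0`. -/
def pathT {A : Type*} [Mul A] [Star A] (P : V → A) (S : W → A) (v₀ : V) (e₀ : W) : List W → A
  | [] => P v₀
  | e :: l => S e * pathT P S v₀ e₀ l * star (S e₀)

variable {A : Type*} [NonUnitalCStarAlgebra A]
variable {E : DirectedGraph V W} {v₀ : V} {e₀ : W} {P : V → A} {S : W → A}

namespace IsTrimmable

section loop

theorem loop_mul_star (h : E.IsTrimmable v₀ e₀) (hF : E.IsCKFamily P S) :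
    S e₀ * star (S e₀) = P v₀ := by
  have := hF.ck2 v₀ {e₀} (fun e => by rw [Finset.mem_singleton, h.src_eq_iff]) ⟨e₀, by simp⟩
  rwa [Finset.sum_singleton] at this

theorem star_mul_loop (h : E.IsTrimmable v₀ e₀) (hF : E.IsCKFamily P S) :
    star (S e₀) * S e₀ = P v₀ := by
  rw [hF.ck1, h.rng_loop]

theorem loop_mul_P (h : E.IsTrimmable v₀ e₀) (hF : E.IsCKFamily P S) : S e₀ * P v₀ = S e₀ := by
  have := hF.S_mul_P e₀
  rwa [h.rng_loop] at this

theorem P_mul_loop (h : E.IsTrimmable v₀ e₀) (hF : E.IsCKFamily P S) : P v₀ * S e₀ = S e₀ := by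
  rw [← h.loop_mul_star hF, hF.partialIsometry]

theorem P_mul_star_loop (h : E.IsTrimmable v₀ e₀) (hF : E.IsCKFamily P S) :
    P v₀ * star (S e₀) = star (S e₀) := by
  have := congrArg star (h.loop_mul_P hF)
  rwa [star_mul, hF.star_proj] at this

theorem star_loop_mul_P (h : E.IsTrimmable v₀ e₀) (hF : E.IsCKFamily P S) :
    star (S e₀) * P v₀ = star (S e₀) := by
  have := congrArg star (h.P_mul_loop hF)
  rwa [star_mul, hF.star_proj] at this

end loop

theorem pathT_mul_P (h : E.IsTrimmable v₀ e₀) (hF : E.IsCKFamily P S) (l : List W) :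
    pathT P S v₀ e₀ l * P v₀ = pathT P S v₀ e₀ l := by
  cases l with
  | nil => exact hF.proj_mul_proj v₀
  | cons e l => rw [pathT, mul_assoc, h.star_loop_mul_P hF]

theorem P_mul_pathT (h : E.IsTrimmable v₀ e₀) (hF : E.IsCKFamily P S) (l : List W) :
    P (E.pathStart v₀ l) * pathT P S v₀ e₀ l = pathT P S v₀ e₀ l := by
  have := h.finite_edges
  cases l with
  | nil => exact hF.proj_mul_proj v₀
  | cons e l => rw [pathT, pathStart, ← mul_assoc, ← mul_assoc, hF.P_src_mul_S]

theorem P_mul_pathT_of_ne (h : E.IsTrimmable v₀ e₀) (hF : E.IsCKFamily P S) {v : V} {l : List W}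
    (hv : v ≠ E.pathStart v₀ l) : P v * pathT P S v₀ e₀ l = 0 := by
  rw [← h.P_mul_pathT hF, ← mul_assoc, hF.orthogonal _ _ hv, zero_mul]

theorem S_mul_pathT (h : E.IsTrimmable v₀ e₀) (hF : E.IsCKFamily P S) (e : W) (l : List W) :
    S e * pathT P S v₀ e₀ l = pathT P S v₀ e₀ (e :: l) * S e₀ := by
  rw [pathT, mul_assoc, h.star_mul_loop hF, mul_assoc, h.pathT_mul_P hF]

theorem S_mul_pathT_of_ne (h : E.IsTrimmable v₀ e₀) (hF : E.IsCKFamily P S) {e : W} {l : List W}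
    (he : E.rng e ≠ E.pathStart v₀ l) : S e * pathT P S v₀ e₀ l = 0 := by
  rw [← hF.S_mul_P, mul_assoc, h.P_mul_pathT_of_ne hF he, mul_zero]

theorem star_S_mul_pathT_cons (h : E.IsTrimmable v₀ e₀) (hF : E.IsCKFamily P S) {e : W}
    {l : List W} (hl : E.IsPathTo v₀ e₀ (e :: l)) :
    star (S e) * pathT P S v₀ e₀ (e :: l) = pathT P S v₀ e₀ l * star (S e₀) := by
  rw [pathT, ← mul_assoc, ← mul_assoc, hF.ck1, hl.2.1, h.P_mul_pathT hF]

theorem star_S_mul_pathT_cons_of_ne (h : E.IsTrimmable v₀ e₀) (hF : E.IsCKFamily P S) {e f : W}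
    (hef : e ≠ f) (l : List W) : star (S e) * pathT P S v₀ e₀ (f :: l) = 0 := by
  have := h.finite_edges
  rw [pathT, ← mul_assoc, ← mul_assoc, hF.star_S_mul_S_of_ne hef, zero_mul, zero_mul]

theorem star_S_mul_P (h : E.IsTrimmable v₀ e₀) (hF : E.IsCKFamily P S) {e : W}
    (he : e ≠ e₀) : star (S e) * P v₀ = 0 := by
  have := h.finite_edges
  have := congrArg star (hF.P_mul_S_of_ne (v := v₀) (e := e) fun hh => he (h.src_eq_iff.1 hh.symm))
  rwa [star_mul, hF.star_proj, star_zero] at this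

theorem star_pathT_mul_self (h : E.IsTrimmable v₀ e₀) (hF : E.IsCKFamily P S) {l : List W}
    (hl : E.IsPathTo v₀ e₀ l) : star (pathT P S v₀ e₀ l) * pathT P S v₀ e₀ l = P v₀ := by
  induction l with
  | nil => rw [pathT, hF.star_proj, hF.proj_mul_proj]
  | cons e l ih =>
    have h1 : star (pathT P S v₀ e₀ (e :: l)) =
        S e₀ * star (pathT P S v₀ e₀ l) * star (S e) := by
      rw [pathT, star_mul, star_mul, star_star, mul_assoc]
    rw [h1, mul_assoc, h.star_S_mul_pathT_cons hF hl, mul_assoc, ← mul_assoc (star _),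
      ih hl.2.2, h.P_mul_star_loop hF, h.loop_mul_star hF]

theorem star_pathT_mul_of_ne (h : E.IsTrimmable v₀ e₀) (hF : E.IsCKFamily P S) {l m : List W}
    (hl : E.IsPathTo v₀ e₀ l) (hm : E.IsPathTo v₀ e₀ m) (hlm : l ≠ m) :
    star (pathT P S v₀ e₀ l) * pathT P S v₀ e₀ m = 0 := by
  have h1 : ∀ e l, star (pathT P S v₀ e₀ (e :: l)) =
      S e₀ * star (pathT P S v₀ e₀ l) * star (S e) := fun e l => by
    rw [pathT, star_mul, star_mul, star_star, mul_assoc]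
  induction l generalizing m with
  | nil =>
    cases m with
    | nil => exact absurd rfl hlm
    | cons f m =>
      rw [pathT, hF.star_proj]
      exact h.P_mul_pathT_of_ne hF fun hh => hm.1 (h.src_eq_iff.1 hh.symm)
  | cons e l ih =>
    rw [h1, mul_assoc]
    cases m with
    | nil => rw [pathT, h.star_S_mul_P hF hl.1, mul_zero]
    | cons f m =>
      by_cases hef : e = f
      · subst hef
        rw [h.star_S_mul_pathT_cons hF hm, mul_assoc, ← mul_assoc (star _),
          ih hl.2.2 hm.2.2 (fun hh => hlm (by rw [hh])), zero_mul, mul_zero]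
      · rw [h.star_S_mul_pathT_cons_of_ne hF hef, mul_zero]

theorem star_pathT_mul (h : E.IsTrimmable v₀ e₀) (hF : E.IsCKFamily P S) [DecidableEq W]
    (μ ν : E.PathTo v₀ e₀) :
    star (pathT P S v₀ e₀ μ) * pathT P S v₀ e₀ ν = if μ = ν then P v₀ else 0 := by
  split_ifs with hh
  · rw [hh, h.star_pathT_mul_self hF ν.2]
  · exact h.star_pathT_mul_of_ne hF μ.2 ν.2 fun h' => hh (Subtype.ext h')

end IsTrimmable

/-! ### The ideal generated by the distinguished vertex projection -/

/-- The C*-algebra `A` is generated by the elements `P v` and `S e`. -/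
def Generates (P : V → A) (S : W → A) : Prop :=
  ∀ B : NonUnitalStarSubalgebra ℂ A, IsClosed (B : Set A) → (∀ v, P v ∈ B) → (∀ e, S e ∈ B) →
    ∀ a, a ∈ B

variable (E v₀ e₀ P S) in
/-- The closed linear span of the elements `t μ * U k * star (t ν)`, where `t μ` is `pathT` and
`U k` is the power `S e₀ ^ k` in the corner of `P v₀`. It is the closed ideal generated by `P v₀`. -/
def loopIdeal : Submodule ℂ A :=
  (Submodule.span ℂ {x | ∃ (μ ν : E.PathTo v₀ e₀) (k : ℤ), x = pathT P S v₀ e₀ μ *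
    (loopPow (P v₀) (S e₀) k * star (pathT P S v₀ e₀ ν))}).topologicalClosure

variable (E v₀ e₀ P S) in
/-- The closed linear span of the matrix units `t μ * star (t ν)`, where `t μ` is `pathT`. -/
def matrixUnitSpan : Submodule ℂ A :=
  (Submodule.span ℂ {x | ∃ (μ ν : E.PathTo v₀ e₀), x = pathT P S v₀ e₀ μ *
    star (pathT P S v₀ e₀ ν)}).topologicalClosure

theorem isClosed_loopIdeal : IsClosed (loopIdeal E v₀ e₀ P S : Set A) :=
  Submodule.isClosed_topologicalClosure _

theorem isClosed_matrixUnitSpan : IsClosed (matrixUnitSpan E v₀ e₀ P S : Set A) :=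
  Submodule.isClosed_topologicalClosure _

namespace IsTrimmable

theorem mem_loopIdeal (μ ν : E.PathTo v₀ e₀) (k : ℤ) : pathT P S v₀ e₀ μ *
    (loopPow (P v₀) (S e₀) k * star (pathT P S v₀ e₀ ν)) ∈ loopIdeal E v₀ e₀ P S :=
  Submodule.le_topologicalClosure _ (Submodule.subset_span ⟨μ, ν, k, rfl⟩)

/-- A continuous additive map sends `loopIdeal` into a closed subspace if it sends the spanning
elements there. The map is only required to be real linear so that `star` is covered. -/
theorem map_mem_of_mem_loopIdeal {B : Type*} [NonUnitalCStarAlgebra B] {J : Submodule ℂ B}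
    (hJ : IsClosed (J : Set B)) {φ : A →ₗ[ℝ] B} (hφ : Continuous φ)
    (hc : ∀ (c : ℂ) x, φ x ∈ J → φ (c • x) ∈ J)
    (h : ∀ (μ ν : E.PathTo v₀ e₀) k, φ (pathT P S v₀ e₀ μ *
      (loopPow (P v₀) (S e₀) k * star (pathT P S v₀ e₀ ν))) ∈ J) {x : A}
    (hx : x ∈ loopIdeal E v₀ e₀ P S) : φ x ∈ J := by
  refine closure_minimal (t := φ ⁻¹' (J : Set B)) ?_ (hJ.preimage hφ) hx
  intro y hy
  induction hy using Submodule.span_induction with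
  | mem y hy => obtain ⟨μ, ν, k, rfl⟩ := hy; exact h μ ν k
  | zero => simp
  | add y z _ _ hy hz =>
    change φ (y + z) ∈ J
    rw [map_add]
    exact J.add_mem hy hz
  | smul c y _ hy => exact hc c y hy

theorem star_mem_loopIdeal (h : E.IsTrimmable v₀ e₀) (hF : E.IsCKFamily P S) {x : A}
    (hx : x ∈ loopIdeal E v₀ e₀ P S) : star x ∈ loopIdeal E v₀ e₀ P S := by
  refine map_mem_of_mem_loopIdeal (φ := (starL' ℝ : A ≃L[ℝ] A).toLinearMap) isClosed_loopIdeal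
    continuous_star (fun c x hx => ?_) (fun μ ν k => ?_) hx
  · change star (c • x) ∈ _
    rw [star_smul]
    exact Submodule.smul_mem _ _ hx
  · change star _ ∈ _
    rw [star_mul, star_mul, star_star, star_loopPow (hF.proj_mul_proj v₀) (h.loop_mul_star hF)
      (h.star_mul_loop hF), mul_assoc]
    exact mem_loopIdeal _ _ _

/-- Left multiplication by `a` preserves `loopIdeal` if it annihilates each `t μ` or changes it into
some `t μ'`, up to a shift of the powers of the loop. -/
theorem mul_mem_loopIdeal_of_gen {a : A} (ha : ∀ (μ : E.PathTo v₀ e₀),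
    a * pathT P S v₀ e₀ μ = 0 ∨ ∃ (μ' : E.PathTo v₀ e₀) (m : ℤ), ∀ k,
      a * (pathT P S v₀ e₀ μ * loopPow (P v₀) (S e₀) k) =
        pathT P S v₀ e₀ μ' * loopPow (P v₀) (S e₀) (k + m)) {x : A}
    (hx : x ∈ loopIdeal E v₀ e₀ P S) : a * x ∈ loopIdeal E v₀ e₀ P S := by
  refine map_mem_of_mem_loopIdeal (φ := LinearMap.mulLeft ℝ a) isClosed_loopIdeal
    (continuous_const_mul a) (fun c x hx => ?_) (fun μ ν k => ?_) hx
  · change a * (c • x) ∈ _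
    rw [mul_smul_comm]
    exact Submodule.smul_mem _ _ hx
  · change a * _ ∈ _
    rcases ha μ with h0 | ⟨μ', m, hm⟩
    · rw [← mul_assoc, h0, zero_mul]
      exact Submodule.zero_mem _
    · rw [← mul_assoc (pathT _ _ _ _ _), ← mul_assoc, hm, mul_assoc]
      exact mem_loopIdeal _ _ _

theorem mul_mem_loopIdeal (h : E.IsTrimmable v₀ e₀) (hF : E.IsCKFamily P S) (hg : Generates P S)
    (a : A) {x : A} (hx : x ∈ loopIdeal E v₀ e₀ P S) : a * x ∈ loopIdeal E v₀ e₀ P S := by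
  have hs := mul_loopPow (hF.proj_mul_proj v₀) (h.loop_mul_star hF) (h.star_mul_loop hF)
  have hs' := star_mul_loopPow (hF.proj_mul_proj v₀) (h.loop_mul_star hF) (h.star_mul_loop hF)
  -- the left multipliers of the ideal whose adjoints are left multipliers, too, form a closed
  -- `*`-subalgebra, so only the generators of `A` have to be considered
  let B : NonUnitalStarSubalgebra ℂ A :=
    { carrier := {a | ∀ x ∈ loopIdeal E v₀ e₀ P S, a * x ∈ loopIdeal E v₀ e₀ P S ∧
        star a * x ∈ loopIdeal E v₀ e₀ P S}
      zero_mem' := fun x _ => by simp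
      add_mem' := fun ha hb x hx => by
        rw [star_add, add_mul, add_mul]
        exact ⟨Submodule.add_mem _ (ha x hx).1 (hb x hx).1,
          Submodule.add_mem _ (ha x hx).2 (hb x hx).2⟩
      mul_mem' := fun ha hb x hx => by
        rw [star_mul, mul_assoc, mul_assoc]
        exact ⟨(ha _ (hb x hx).1).1, (hb _ (ha x hx).2).2⟩
      smul_mem' := fun c a ha x hx => by
        rw [star_smul, smul_mul_assoc, smul_mul_assoc]
        exact ⟨Submodule.smul_mem _ _ (ha x hx).1, Submodule.smul_mem _ _ (ha x hx).2⟩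
      star_mem' := fun ha x hx => by
        rw [star_star]
        exact (ha x hx).symm }
  have hB : IsClosed (B : Set A) := by
    have : (B : Set A) = ⋂ x ∈ loopIdeal E v₀ e₀ P S,
        {a | a * x ∈ (loopIdeal E v₀ e₀ P S : Set A)} ∩
          {a | star a * x ∈ (loopIdeal E v₀ e₀ P S : Set A)} := by
      ext a; simp [B]; rfl
    rw [this]
    exact isClosed_biInter fun x _ => (isClosed_loopIdeal.preimage (continuous_mul_const x)).inter
      (isClosed_loopIdeal.preimage (continuous_star.mul continuous_const))
  have hP : ∀ v, ∀ x ∈ loopIdeal E v₀ e₀ P S, P v * x ∈ loopIdeal E v₀ e₀ P S := by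
    refine fun v x hx => mul_mem_loopIdeal_of_gen (fun μ => ?_) hx
    by_cases hv : v = E.pathStart v₀ μ
    · exact Or.inr ⟨μ, 0, fun k => by rw [add_zero, ← mul_assoc, hv, h.P_mul_pathT hF]⟩
    · exact Or.inl (h.P_mul_pathT_of_ne hF hv)
  refine (hg B hB (fun v x hx => ⟨hP v x hx, ?_⟩) (fun e x hx => ⟨?_, ?_⟩) a x hx).1
  · rw [hF.star_proj]
    exact hP v x hx
  · refine mul_mem_loopIdeal_of_gen (fun μ => ?_) hx
    by_cases hv : E.rng e = E.pathStart v₀ μ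
    · by_cases he : e = e₀
      · subst he
        obtain ⟨_ | ⟨f, l⟩, hl⟩ := μ
        · refine Or.inr ⟨⟨[], trivial⟩, 1, fun k => ?_⟩
          change S e * (P v₀ * _) = P v₀ * _
          rw [← mul_assoc, h.loop_mul_P hF, ← hs, ← mul_assoc, h.P_mul_loop hF]
        · rw [h.rng_loop] at hv
          exact absurd (h.src_eq_iff.1 hv.symm) hl.1
      · refine Or.inr ⟨⟨e :: μ, he, hv, μ.2⟩, 1, fun k => ?_⟩
        rw [← mul_assoc, h.S_mul_pathT hF, mul_assoc, hs]
    · exact Or.inl (h.S_mul_pathT_of_ne hF hv)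
  · refine mul_mem_loopIdeal_of_gen (fun μ => ?_) hx
    obtain ⟨_ | ⟨f, l⟩, hl⟩ := μ
    · by_cases he : e = e₀
      · subst he
        refine Or.inr ⟨⟨[], trivial⟩, -1, fun k => ?_⟩
        change star (S e) * (P v₀ * _) = P v₀ * _
        rw [← mul_assoc, h.star_loop_mul_P hF, ← sub_eq_add_neg, ← hs', ← mul_assoc,
          h.P_mul_star_loop hF]
      · exact Or.inl (h.star_S_mul_P hF he)
    · by_cases he : e = f
      · subst he
        refine Or.inr ⟨⟨l, hl.2.2⟩, -1, fun k => ?_⟩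
        rw [← mul_assoc, h.star_S_mul_pathT_cons hF hl, mul_assoc, hs', sub_eq_add_neg]
      · exact Or.inl (h.star_S_mul_pathT_cons_of_ne hF he l)

theorem isProjIdeal_loopIdeal (h : E.IsTrimmable v₀ e₀) (hF : E.IsCKFamily P S)
    (hg : Generates P S) : (loopIdeal E v₀ e₀ P S).IsProjIdeal := by
  classical
  refine ⟨fun a x hx => h.mul_mem_loopIdeal hF hg a hx, fun a x hx => ?_, fun x hx ε hε => ?_⟩
  · have := h.star_mem_loopIdeal hF
      (h.mul_mem_loopIdeal hF hg (star a) (h.star_mem_loopIdeal hF hx))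
    rwa [star_mul, star_star, star_star] at this
  -- the finite sums of the projections `t μ * star (t μ)` form the approximate unit
  let q : Finset (E.PathTo v₀ e₀) → A := fun F =>
    ∑ μ ∈ F, pathT P S v₀ e₀ μ * star (pathT P S v₀ e₀ μ)
  have hqstar : ∀ F, star (q F) = q F := fun F => by
    simp only [q, star_sum, star_mul, star_star]
  have hqt : ∀ F, ∀ μ : E.PathTo v₀ e₀, μ ∈ F → star (pathT P S v₀ e₀ μ) * q F = star (pathT P S v₀ e₀ μ) := by
    intro F μ hμ
    simp only [q, Finset.mul_sum, ← mul_assoc, h.star_pathT_mul hF]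
    rw [Finset.sum_eq_single_of_mem μ hμ fun ν _ hν => by rw [if_neg hν.symm, zero_mul], if_pos rfl]
    have := congrArg star (h.pathT_mul_P hF (S := S) (P := P) μ)
    rwa [star_mul, hF.star_proj] at this
  have hq : ∀ F, IsStarProjection (q F) := fun F => by
    refine ⟨?_, hqstar F⟩
    change (∑ μ ∈ F, _) * q F = ∑ μ ∈ F, _
    rw [Finset.sum_mul]
    exact Finset.sum_congr rfl fun μ hμ => by rw [mul_assoc, hqt F μ hμ]
  have hqJ : ∀ F, q F ∈ loopIdeal E v₀ e₀ P S := fun F => Submodule.sum_mem _ fun μ _ => by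
    have := mem_loopIdeal (P := P) (S := S) μ μ 0
    rwa [loopPow_zero, ← mul_assoc, h.pathT_mul_P hF] at this
  have key : ∀ y ∈ Submodule.span ℂ {x | ∃ (μ ν : E.PathTo v₀ e₀) (k : ℤ), x =
      pathT P S v₀ e₀ μ * (loopPow (P v₀) (S e₀) k * star (pathT P S v₀ e₀ ν))},
      ∃ F₀, ∀ F, F₀ ⊆ F → y * q F = y := by
    intro y hy
    induction hy using Submodule.span_induction with
    | mem y hy =>
      obtain ⟨μ, ν, k, rfl⟩ := hy
      exact ⟨{ν}, fun F hF' => by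
        rw [mul_assoc, mul_assoc, hqt F ν (Finset.singleton_subset_iff.1 hF')]⟩
    | zero => exact ⟨∅, fun F _ => zero_mul _⟩
    | add y z _ _ hy hz =>
      obtain ⟨F₁, h₁⟩ := hy
      obtain ⟨F₂, h₂⟩ := hz
      exact ⟨F₁ ∪ F₂, fun F hF' => by
        rw [add_mul, h₁ F (Finset.union_subset_left hF'), h₂ F (Finset.union_subset_right hF')]⟩
    | smul c y _ hy =>
      obtain ⟨F₁, h₁⟩ := hy
      exact ⟨F₁, fun F hF' => by rw [smul_mul_assoc, h₁ F hF']⟩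
  obtain ⟨y, hy, hxy⟩ := Metric.mem_closure_iff.1 hx ε hε
  obtain ⟨F, hFy⟩ := key y hy
  refine ⟨q F, hqJ F, hq F, ?_⟩
  have h1 : x - x * q F = (x - y) - (x - y) * q F := by
    rw [sub_mul, hFy F subset_rfl]
    abel
  rw [h1]
  exact ((hq F).norm_sub_mul_le _).trans_lt (by rwa [dist_eq_norm] at hxy)

end IsTrimmable
end DirectedGraph

/-! ### The kernel and the range of the quotient map -/

namespace DirectedGraph

variable {V W : Type*}

/-- A graph C*-algebra is generated by its vertex projections and edge partial isometries. -/
theorem CStar.generates (E : DirectedGraph V W) : Generates (CStar.P E) (CStar.S E) := by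
  intro B hB hP hS a
  have key : ∀ x : E.FreeStarAlg, (CStarCompletion.coe x : CStarCompletion E.FreeStarAlg) ∈
      (B : Set E.CStar) := fun x => by
    induction x using FreeStarAlg.gen_ind with
    | zero => exact B.zero_mem
    | add x y hx hy =>
      rw [CStarCompletion.coe_add]
      exact B.add_mem hx hy
    | mul x y hx hy =>
      rw [CStarCompletion.coe_mul]
      exact B.mul_mem hx hy
    | smul z x hx =>
      rw [CStarCompletion.coe_smul]
      exact SMulMemClass.smul_mem z hx
    | star_mem x hx =>
      rw [CStarCompletion.coe_star]
      exact B.star_mem' hx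
    | gen_mem x =>
      rcases x with v | e
      · exact hP v
      · exact hS e
  exact CStarCompletion.ind (F := E.FreeStarAlg) (p := fun x => x ∈ (B : Set E.CStar)) a hB key

variable {A : Type*} [NonUnitalCStarAlgebra A]
variable {E : DirectedGraph V W} {v₀ : V} {e₀ : W} {P : V → A} {S : W → A}

theorem continuous_starHom {B : Type*} [NonUnitalCStarAlgebra B] (φ : A →⋆ₙₐ[ℂ] B) :
    Continuous φ :=
  (NonUnitalStarAlgHom.instContinuousLinearMapClassComplex (F := A →⋆ₙₐ[ℂ] B)).map_continuous φ

theorem CKRelations.P_mem_loopIdeal (hF : E.IsCKFamily P S) (v₀ : V) (e₀ : W) :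
    P v₀ ∈ loopIdeal E v₀ e₀ P S := by
  have := IsTrimmable.mem_loopIdeal (E := E) (v₀ := v₀) (e₀ := e₀) (P := P) (S := S) ⟨[], trivial⟩
    ⟨[], trivial⟩ 0
  rwa [loopPow_zero, pathT, hF.star_proj, hF.proj_mul_proj, hF.proj_mul_proj] at this

namespace IsTrimmable

theorem map_eq_zero_of_mem_loopIdeal (h : E.IsTrimmable v₀ e₀) (hF : E.IsCKFamily P S)
    {B : Type*} [NonUnitalCStarAlgebra B] {π : A →⋆ₙₐ[ℂ] B} (hπ : π (P v₀) = 0) {x : A}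
    (hx : x ∈ loopIdeal E v₀ e₀ P S) : π x = 0 := by
  refine map_mem_of_mem_loopIdeal (J := (⊥ : Submodule ℂ B)) (by simp)
    (φ := (π : A →ₗ[ℂ] B).restrictScalars ℝ) (continuous_starHom π) (fun c x hx => ?_)
    (fun μ ν k => ?_) hx
  · change π x = 0 at hx
    change π (c • x) = 0
    rw [map_smul, hx, smul_zero]
  · change π _ = 0
    rw [← h.pathT_mul_P hF, map_mul, map_mul, hπ, mul_zero, zero_mul]

/-- The quotient norm modulo `loopIdeal`, pulled back to the free `*`-algebra on the graph without
`v₀`, is an admissible seminorm, and therefore bounded by the universal one. -/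
theorem norm_mk_eval_le (h : E.IsTrimmable v₀ e₀) (hF : E.IsCKFamily P S) (hg : Generates P S)
    (x : (E.deleteVertex v₀).FreeStarAlg) :
    ‖(loopIdeal E v₀ e₀ P S).mkQ ((FreeStarAlg.eval (Sum.elim (fun v => P v.1) fun e => S e.1) :
      (E.deleteVertex v₀).FreeStarAlg →⋆ₙₐ[ℂ] A) x)‖ ≤ ‖x‖ := by
  classical
  have := h.finite_edges
  have := Fintype.ofFinite W
  have hJ := h.isProjIdeal_loopIdeal hF hg
  set J := loopIdeal E v₀ e₀ P S
  obtain ⟨φ, hφ⟩ : ∃ φ : (E.deleteVertex v₀).FreeStarAlg →⋆ₙₐ[ℂ] A,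
    φ = FreeStarAlg.eval (Sum.elim (fun v => P v.1) fun e => S e.1) := ⟨_, rfl⟩
  rw [← hφ]
  have hP : ∀ v, φ (FreeStarAlg.gen (Sum.inl v)) = P v.1 := fun v =>
    hφ ▸ FreeStarAlg.eval_gen _ _
  have hS : ∀ e, φ (FreeStarAlg.gen (Sum.inr e)) = S e.1 := fun e =>
    hφ ▸ FreeStarAlg.eval_gen _ _
  let p : Seminorm ℂ (E.deleteVertex v₀).FreeStarAlg := Seminorm.of (fun x => ‖J.mkQ (φ x)‖)
    (fun x y => by rw [map_add, map_add]; exact norm_add_le _ _)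
    (fun c x => by rw [map_smul, map_smul, norm_smul])
  have hp0 : ∀ x y, φ x = φ y → p (x - y) = 0 := fun x y h => by
    change ‖J.mkQ (φ (x - y))‖ = 0
    rw [map_sub, h, sub_self, map_zero, norm_zero]
  have hp : FreeStarAlg.Admissible p :=
    { mul_le := fun x y => by
        change ‖J.mkQ (φ (x * y))‖ ≤ ‖J.mkQ (φ x)‖ * ‖J.mkQ (φ y)‖
        rw [map_mul]; exact hJ.norm_mk_mul_le _ _
      star_mul_self := fun x => by
        change ‖J.mkQ (φ (star x * x))‖ = ‖J.mkQ (φ x)‖ * ‖J.mkQ (φ x)‖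
        rw [map_mul, map_star]; exact hJ.norm_mk_star_mul_self isClosed_loopIdeal _
      relations :=
        { star_proj := fun v => hp0 _ _ (by simp only [map_star, hP, hF.star_proj])
          proj_mul_proj := fun v => hp0 _ _ (by simp only [map_mul, hP, hF.proj_mul_proj])
          orthogonal := fun v w hvw => hp0 _ _ (by
            simp only [map_mul, map_zero, hP, hF.orthogonal v.1 w.1 fun hh => hvw (Subtype.ext hh)])
          partialIsometry := fun e => hp0 _ _ (by
            simp only [map_mul, map_star, hS, hF.partialIsometry e.1])
          ck1 := fun e => hp0 _ _ (by simp only [map_mul, map_star, hS, hP, hF.ck1 e.1]; rfl)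
          ck2 := fun v t ht ht' => by
            change ‖J.mkQ (φ _)‖ = 0
            -- the edges from `v` to `v₀` contribute elements of the ideal
            have h1 : φ (∑ e ∈ t, FreeStarAlg.gen (Sum.inr e) * star (FreeStarAlg.gen (Sum.inr e))
                - FreeStarAlg.gen (Sum.inl v)) =
                - ∑ e ∈ Finset.univ.filter (fun e => E.src e = v.1 ∧ E.rng e = v₀),
                  S e * star (S e) := by
              have h2 := hF.ck2 v.1 {e | E.src e = v.1} (by simp) (by
                obtain ⟨e, he⟩ := ht'
                exact ⟨e.1, Finset.mem_filter.2 ⟨Finset.mem_univ _, congrArg Subtype.val ((ht e).1 he)⟩⟩)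
              rw [map_sub, map_sum, hP, ← h2]
              simp only [map_mul, map_star, hS]
              rw [← Finset.sum_filter_add_sum_filter_not {e | E.src e = v.1} (fun e => E.rng e = v₀),
                Finset.filter_filter, Finset.filter_filter, sub_eq_iff_eq_add, neg_add_cancel_left,
                ← Finset.sum_image (s := t) (g := Subtype.val) (f := fun e => S e * star (S e))
                  Subtype.val_injective.injOn]
              refine Finset.sum_congr ?_ fun _ _ => rfl
              ext e
              simp only [Finset.mem_image, Finset.mem_filter, Finset.mem_univ, true_and]
              constructor
              · rintro ⟨e, he, rfl⟩
                exact ⟨congrArg Subtype.val ((ht e).1 he), e.2.2⟩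
              · rintro ⟨he, he'⟩
                exact ⟨⟨e, by rw [he]; exact v.2, he'⟩, (ht _).2 (Subtype.ext he), rfl⟩
            suffices h2 : J.mkQ (∑ e ∈ Finset.univ.filter (fun e => E.src e = v.1 ∧ E.rng e = v₀),
                S e * star (S e)) = 0 by rw [h1, map_neg, h2, neg_zero, norm_zero]
            rw [Submodule.mkQ_apply, Submodule.Quotient.mk_eq_zero]
            refine J.sum_mem fun e he => hJ.mul_right _ _ ?_
            simp only [Finset.mem_filter, Finset.mem_univ, true_and] at he
            rw [← hF.S_mul_P, he.2]
            exact hJ.mul_left _ _ (hF.P_mem_loopIdeal v₀ e₀) } }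
  exact FreeStarAlg.le_iSup hp x

variable {π : A →⋆ₙₐ[ℂ] (E.deleteVertex v₀).CStar}

/-- The quotient map is isometric modulo the ideal generated by `P v₀`: up to elements of the ideal,
`A` consists of limits of elements that come from the free `*`-algebra on the graph without `v₀`. -/
theorem norm_mk_le_norm_map (h : E.IsTrimmable v₀ e₀) (hF : E.IsCKFamily P S) (hg : Generates P S)
    (hπP : ∀ v, π (P v) = E.quotP v₀ v) (hπS : ∀ e, π (S e) = E.quotS v₀ e) (a : A) :
    ‖(loopIdeal E v₀ e₀ P S).mkQ a‖ ≤ ‖π a‖ := by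
  have hJ := h.isProjIdeal_loopIdeal hF hg
  have hle := h.norm_mk_eval_le hF hg
  have hstar : ∀ {x}, x ∈ loopIdeal E v₀ e₀ P S → star x ∈ loopIdeal E v₀ e₀ P S :=
    fun hx => h.star_mem_loopIdeal hF hx
  have hPJ := hF.P_mem_loopIdeal v₀ e₀
  have hker : ∀ {x}, x ∈ loopIdeal E v₀ e₀ P S → π x = 0 := fun hx =>
    h.map_eq_zero_of_mem_loopIdeal hF (by rw [hπP, quotP_self]) hx
  set J := loopIdeal E v₀ e₀ P S
  obtain ⟨φ, hφ⟩ : ∃ φ : (E.deleteVertex v₀).FreeStarAlg →⋆ₙₐ[ℂ] A,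
    φ = FreeStarAlg.eval (Sum.elim (fun v => P v.1) fun e => S e.1) := ⟨_, rfl⟩
  rw [← hφ] at hle
  have hP : ∀ v, φ (FreeStarAlg.gen (Sum.inl v)) = P v.1 := fun v =>
    hφ ▸ FreeStarAlg.eval_gen _ _
  have hS : ∀ e, φ (FreeStarAlg.gen (Sum.inr e)) = S e.1 := fun e =>
    hφ ▸ FreeStarAlg.eval_gen _ _
  have hπφ : ∀ x, ‖π (φ x)‖ = ‖x‖ := fun x => by
    have : π (φ x) = (CStarCompletion.coe x : CStarCompletion (E.deleteVertex v₀).FreeStarAlg) := by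
      induction x using FreeStarAlg.gen_ind with
      | zero => rw [map_zero, map_zero]; rfl
      | add x y hx hy => rw [map_add, map_add, hx, hy]; exact (CStarCompletion.coe_add x y).symm
      | mul x y hx hy => rw [map_mul, map_mul, hx, hy]; exact (CStarCompletion.coe_mul x y).symm
      | smul z x hx => rw [map_smul, map_smul, hx]; exact (CStarCompletion.coe_smul z x).symm
      | star_mem x hx => rw [map_star, map_star, hx]; exact (CStarCompletion.coe_star x).symm
      | gen_mem x =>
        rcases x with v | e
        · rw [hP, hπP, quotP_of_ne v.2]; rfl
        · rw [hS, hπS, quotS_of e.2]; rfl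
    rw [this]
    exact CStarCompletion.norm_coe x
  -- the dense `*`-subalgebra of elements that come from the free algebra modulo the ideal
  let D : NonUnitalStarSubalgebra ℂ A :=
    { carrier := {a | ∃ x, a - φ x ∈ J}
      zero_mem' := ⟨0, by simp⟩
      add_mem' := by
        rintro a b ⟨x, hx⟩ ⟨y, hy⟩
        exact ⟨x + y, by rw [map_add, add_sub_add_comm]; exact J.add_mem hx hy⟩
      mul_mem' := by
        rintro a b ⟨x, hx⟩ ⟨y, hy⟩
        refine ⟨x * y, ?_⟩
        have : a * b - φ (x * y) = (a - φ x) * b + φ x * (b - φ y) := by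
          rw [map_mul]; noncomm_ring
        rw [this]
        exact J.add_mem (hJ.mul_right _ _ hx) (hJ.mul_left _ _ hy)
      smul_mem' := by
        rintro c a ⟨x, hx⟩
        exact ⟨c • x, by rw [map_smul, ← smul_sub]; exact J.smul_mem _ hx⟩
      star_mem' := by
        rintro a ⟨x, hx⟩
        exact ⟨star x, by rw [map_star, ← star_sub]; exact hstar hx⟩ }
  have hD : ∀ a, a ∈ closure (D : Set A) := by
    refine hg D.topologicalClosure isClosed_closure (fun v => ?_) (fun e => ?_)
    · refine subset_closure ?_
      by_cases hv : v = v₀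
      · exact ⟨0, by rw [map_zero, sub_zero, hv]; exact hPJ⟩
      · exact ⟨FreeStarAlg.gen (Sum.inl ⟨v, hv⟩), by rw [hP, sub_self]; exact J.zero_mem⟩
    · refine subset_closure ?_
      by_cases he : E.rng e = v₀
      · refine ⟨0, ?_⟩
        rw [map_zero, sub_zero, ← hF.S_mul_P, he]
        exact hJ.mul_left _ _ hPJ
      · have he' : E.src e ≠ v₀ := fun hh => he (by rw [h.src_eq_iff.1 hh, h.rng_loop])
        exact ⟨FreeStarAlg.gen (Sum.inr ⟨e, he', he⟩), by rw [hS, sub_self]; exact J.zero_mem⟩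
  have hmk : Continuous J.mkQ := continuous_quot_mk
  refine closure_minimal (t := {a | ‖J.mkQ a‖ ≤ ‖π a‖}) ?_
    (isClosed_le hmk.norm (continuous_starHom π).norm) (hD a)
  rintro a ⟨x, hx⟩
  have h1 : J.mkQ a = J.mkQ (φ x) := (Submodule.Quotient.eq J).2 hx
  have h2 : π a = π (φ x) := by rw [← sub_eq_zero, ← map_sub, hker hx]
  change ‖J.mkQ a‖ ≤ ‖π a‖
  rw [h1, h2, hπφ]
  exact hle x

theorem mem_loopIdeal_of_map_eq_zero (h : E.IsTrimmable v₀ e₀) (hF : E.IsCKFamily P S)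
    (hg : Generates P S) (hπP : ∀ v, π (P v) = E.quotP v₀ v) (hπS : ∀ e, π (S e) = E.quotS v₀ e)
    {a : A} (ha : π a = 0) : a ∈ loopIdeal E v₀ e₀ P S := by
  have h1 := h.norm_mk_le_norm_map hF hg hπP hπS a
  rw [ha, norm_zero] at h1
  have h2 := QuotientAddGroup.norm_mk_eq_zero_iff_mem_closure.1 (le_antisymm h1 (norm_nonneg _))
  exact isClosed_loopIdeal.closure_subset h2

theorem map_surjective (h : E.IsTrimmable v₀ e₀) (hF : E.IsCKFamily P S)
    (hg : Generates P S) (hπP : ∀ v, π (P v) = E.quotP v₀ v) (hπS : ∀ e, π (S e) = E.quotS v₀ e) :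
    Function.Surjective π := by
  let f : NormedAddGroupHom A (E.deleteVertex v₀).CStar :=
    { toFun := π
      map_add' := map_add π
      bound' := ⟨1, fun a => by rw [one_mul]; exact NonUnitalStarAlgHom.norm_apply_le π a⟩ }
  let K : AddSubgroup (E.deleteVertex v₀).CStar := (π : A →+ (E.deleteVertex v₀).CStar).range
  -- preimages can be chosen with norm control since `π` is isometric modulo its kernel
  have hK : f.SurjectiveOnWith K 2 := by
    rintro _ ⟨a, rfl⟩
    change ∃ g, π g = π a ∧ ‖g‖ ≤ 2 * ‖π a‖
    rcases (norm_nonneg (π a)).eq_or_lt with h0 | h0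
    · exact ⟨0, by rw [map_zero, norm_eq_zero.1 h0.symm], by rw [norm_zero, ← h0, mul_zero]⟩
    · obtain ⟨x, hx, hx'⟩ := Submodule.Quotient.norm_mk_lt ((loopIdeal E v₀ e₀ P S).mkQ a) h0
      refine ⟨x, ?_, ?_⟩
      · rw [← sub_eq_zero, ← map_sub]
        refine h.map_eq_zero_of_mem_loopIdeal hF (by rw [hπP, quotP_self]) ?_
        exact (Submodule.Quotient.eq _).1 hx
      · have := h.norm_mk_le_norm_map hF hg hπP hπS a
        linarith
  intro b
  have hb : b ∈ K.topologicalClosure := by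
    refine CStar.generates _ (NonUnitalStarAlgHom.range π).topologicalClosure isClosed_closure
      (fun v => ?_) (fun e => ?_) b
    · exact subset_closure ⟨P v.1, by rw [← quotP_of_ne v.2]; exact hπP _⟩
    · exact subset_closure ⟨S e.1, by rw [← quotS_of e.2]; exact hπS _⟩
  obtain ⟨a, ha, -⟩ := controlled_closure_of_complete two_pos one_pos hK b hb
  exact ⟨a, ha⟩

end IsTrimmable
end DirectedGraph

/-! ### Averaging over the gauge action -/

namespace DirectedGraph

variable {V W : Type*}

namespace CStar

variable {E : DirectedGraph V W}

open MeasureTheory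

theorem gauge_P (z : Circle) (v : V) : CStar.gauge E z (P E v) = P E v := lift_P _ _

theorem gauge_S (z : Circle) (e : W) : CStar.gauge E z (S E e) = (z : ℂ) • S E e := lift_S _ _

theorem gauge_gauge (z w : Circle) (x : E.CStar) :
    CStar.gauge E z (gauge E w x) = gauge E (z * w) x := by
  have : (CStar.gauge E z).comp (gauge E w) = gauge E (z * w) := by
    refine hom_ext (fun v => ?_) fun e => ?_
    · simp only [NonUnitalStarAlgHom.comp_apply, gauge_P]
    · simp only [NonUnitalStarAlgHom.comp_apply, gauge_S, map_smul, smul_smul,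
        Circle.coe_mul, mul_comm]
  exact DFunLike.congr_fun this x

theorem continuous_gauge (x : E.CStar) : Continuous fun z => CStar.gauge E z x := by
  let B : NonUnitalStarSubalgebra ℂ E.CStar :=
    { carrier := {x | Continuous fun z => CStar.gauge E z x}
      zero_mem' := by simpa using continuous_const
      add_mem' := fun {x y} hx hy => by
        simp only [Set.mem_ofPred_eq, map_add]; exact Continuous.add hx hy
      mul_mem' := fun {x y} hx hy => by
        simp only [Set.mem_ofPred_eq, map_mul]; exact Continuous.mul hx hy
      smul_mem' := fun c x hx => by
        simp only [Set.mem_ofPred_eq, map_smul]; exact Continuous.const_smul hx c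
      star_mem' := fun {x} hx => by
        simp only [Set.mem_ofPred_eq, map_star]; exact Continuous.star hx }
  refine CStar.generates E B ?_ (fun v => ?_) (fun e => ?_) x
  · refine isClosed_of_closure_subset fun x hx => ?_
    refine continuous_of_uniform_approx_of_continuous fun u hu => ?_
    obtain ⟨ε, hε, hu⟩ := Metric.mem_uniformity_dist.1 hu
    obtain ⟨y, hy, hxy⟩ := Metric.mem_closure_iff.1 hx ε hε
    refine ⟨_, hy, fun z => hu ?_⟩
    rw [dist_eq_norm, ← map_sub]
    rw [dist_eq_norm] at hxy
    exact (NonUnitalStarAlgHom.norm_apply_le (CStar.gauge E z) _).trans_lt hxy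
  · change Continuous fun z => CStar.gauge E z (P E v)
    simpa only [gauge_P] using continuous_const
  · change Continuous fun z => CStar.gauge E z (S E e)
    simp only [gauge_S]
    exact continuous_subtype_val.smul continuous_const

/-- The Borel σ-algebra of the circle. -/
instance : MeasurableSpace Circle := borel Circle

instance : BorelSpace Circle := ⟨rfl⟩

/-- The normalized Haar measure of the circle. -/
def circleHaar : Measure Circle := Measure.haarMeasure ⊤

instance : circleHaar.IsHaarMeasure := by unfold circleHaar; infer_instance

instance : IsProbabilityMeasure circleHaar :=
  ⟨by simpa [circleHaar] using
    Measure.haarMeasure_self (K₀ := (⊤ : TopologicalSpace.PositiveCompacts Circle))⟩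

/-- The average of an element over the gauge action. -/
def average (x : E.CStar) : E.CStar := ∫ z, CStar.gauge E z x ∂circleHaar

theorem integrable_gauge (x : E.CStar) : Integrable (fun z => CStar.gauge E z x) circleHaar :=
  (continuous_gauge x).integrable_of_hasCompactSupport (HasCompactSupport.of_compactSpace _)

theorem average_add (x y : E.CStar) : average (x + y) = average x + average y := by
  simp only [average, map_add]
  exact integral_add (integrable_gauge x) (integrable_gauge y)

theorem average_smul (c : ℂ) (x : E.CStar) : average (c • x) = c • average x := by
  simp only [average, map_smul]
  exact integral_smul c _

theorem norm_average_le (x : E.CStar) : ‖average x‖ ≤ ‖x‖ := by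
  refine (norm_integral_le_of_norm_le_const (C := ‖x‖)
    (Filter.Eventually.of_forall fun z => NonUnitalStarAlgHom.norm_apply_le (CStar.gauge E z) x)).trans ?_
  simp

theorem average_of_mem {x : E.CStar} (hx : x ∈ gaugeFixed E) : average x = x := by
  have : ∀ z, CStar.gauge E z x = x := hx
  simp [average, this]

theorem average_gauge (w : Circle) (x : E.CStar) : average (gauge E w x) = average x := by
  simp only [average, gauge_gauge]
  exact integral_mul_right_eq_self (μ := circleHaar) (fun z => CStar.gauge E z x) w

theorem map_average {A : Type*} [NonUnitalCStarAlgebra A] (φ : E.CStar →⋆ₙₐ[ℂ] A) (x : E.CStar) :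
    φ (average x) = ∫ z, φ (CStar.gauge E z x) ∂circleHaar :=
  ((⟨φ, continuous_starHom φ⟩ : E.CStar →L[ℂ] A).integral_comp_comm (integrable_gauge x)).symm

theorem average_mem (x : E.CStar) : average x ∈ gaugeFixed E := by
  intro w
  rw [map_average]
  simp only [gauge_gauge]
  exact integral_mul_left_eq_self (μ := circleHaar) (fun z => CStar.gauge E z x) w

end CStar

namespace IsTrimmable

variable {E : DirectedGraph V W} {v₀ : V} {e₀ : W}

open CStar

theorem gauge_pathT (z : Circle) (l : List W) :
    CStar.gauge E z (pathT (P E) (S E) v₀ e₀ l) = pathT (P E) (S E) v₀ e₀ l := by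
  have hz : (z : ℂ) * star (z : ℂ) = 1 := by simp [← Circle.coe_inv_eq_conj]
  induction l with
  | nil => simp only [pathT, gauge_P]
  | cons e l ih =>
    rw [pathT, map_mul, map_mul, ih, map_star]
    simp only [gauge_S, star_smul, smul_mul_assoc, mul_smul_comm, smul_smul]
    rw [mul_comm, hz, one_smul]

theorem gauge_loopPow (z : Circle) (k : ℤ) :
    CStar.gauge E z (loopPow (P E v₀) (S E e₀) k) = ((z ^ k : Circle) : ℂ) • loopPow (P E v₀) (S E e₀) k := by
  have hS : CStar.gauge E z (S E e₀) = (z : ℂ) • S E e₀ := by simp only [gauge_S]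
  have h1 : ∀ n : ℕ, CStar.gauge E z (((S E e₀) * ·)^[n] (P E v₀)) =
      ((z : ℂ) ^ n) • ((S E e₀) * ·)^[n] (P E v₀) := by
    intro n
    induction n with
    | zero => simp only [Function.iterate_zero, id, pow_zero, one_smul, gauge_P]
    | succ n ih =>
      rw [Function.iterate_succ_apply', map_mul, ih, hS, smul_mul_smul_comm, pow_succ']
  have h2 : ∀ n : ℕ, CStar.gauge E z ((star (S E e₀) * ·)^[n] (P E v₀)) =
      (star (z : ℂ) ^ n) • (star (S E e₀) * ·)^[n] (P E v₀) := by
    intro n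
    induction n with
    | zero => simp only [Function.iterate_zero, id, pow_zero, one_smul, gauge_P]
    | succ n ih =>
      rw [Function.iterate_succ_apply', map_mul, ih, map_star, hS, star_smul, smul_mul_smul_comm,
        pow_succ']
  rcases k with n | n
  · change _ = ((z ^ (n : ℤ) : Circle) : ℂ) • _
    rw [zpow_natCast, Circle.coe_pow]
    exact h1 n
  · rw [zpow_negSucc, Circle.coe_inv_eq_conj, Circle.coe_pow, map_pow]
    exact h2 (n + 1)

/-- The gauge-invariant elements of the ideal generated by `P v₀` lie in the closed span of the
matrix units: averaging annihilates the spanning elements of nonzero degree. -/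
theorem mem_matrixUnitSpan (h : E.IsTrimmable v₀ e₀) {x : E.CStar}
    (hx : x ∈ loopIdeal E v₀ e₀ (P E) (S E)) (hx' : x ∈ gaugeFixed E) :
    x ∈ matrixUnitSpan E v₀ e₀ (P E) (S E) := by
  rw [← average_of_mem hx']
  have hlip : LipschitzWith 1 (average (E := E)) := LipschitzWith.of_dist_le_mul fun x y => by
    have : average x - average y = average (x - y) := by
      rw [sub_eq_iff_eq_add, ← average_add, sub_add_cancel]
    rw [dist_eq_norm, dist_eq_norm, this, NNReal.coe_one, one_mul]
    exact norm_average_le _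
  refine map_mem_of_mem_loopIdeal (φ := ⟨⟨average, average_add⟩, fun c x => ?_⟩)
    isClosed_matrixUnitSpan hlip.continuous (fun c x hx => ?_) (fun μ ν k => ?_) hx
  · exact average_smul (c : ℂ) x
  · change average (c • x) ∈ _
    rw [average_smul]
    exact Submodule.smul_mem _ _ hx
  · change average _ ∈ _
    have hg : ∀ z, CStar.gauge E z (pathT (P E) (S E) v₀ e₀ μ * (loopPow (P E v₀) (S E e₀) k *
        star (pathT (P E) (S E) v₀ e₀ ν))) = ((z ^ k : Circle) : ℂ) •
        (pathT (P E) (S E) v₀ e₀ μ * (loopPow (P E v₀) (S E e₀) k *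
        star (pathT (P E) (S E) v₀ e₀ ν))) := fun z => by
      rw [map_mul, map_mul, map_star, gauge_pathT, gauge_pathT, gauge_loopPow,
        smul_mul_assoc, mul_smul_comm]
    by_cases hk : k = 0
    · subst hk
      rw [average_of_mem fun z => by rw [hg, zpow_zero, Circle.coe_one, one_smul], loopPow_zero,
        ← mul_assoc, h.pathT_mul_P (isCKFamily E)]
      exact Submodule.le_topologicalClosure _ (Submodule.subset_span ⟨μ, ν, rfl⟩)
    · set y := pathT (P E) (S E) v₀ e₀ μ * (loopPow (P E v₀) (S E e₀) k *
        star (pathT (P E) (S E) v₀ e₀ ν))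
      have hz : ∃ z : Circle, z ^ k ≠ 1 := by
        refine ⟨Circle.exp (Real.pi / k), fun hh => ?_⟩
        rw [← Circle.exp_zsmul, zsmul_eq_mul, mul_div_cancel₀ _ (Int.cast_ne_zero.2 hk)] at hh
        exact Circle.exp_pi_ne_one hh
      obtain ⟨z, hz⟩ := hz
      have h1 := average_gauge z y
      rw [hg, average_smul, ← sub_eq_zero, ← one_smul ℂ (average y), smul_smul, mul_one,
        ← sub_smul, smul_eq_zero, sub_eq_zero] at h1
      rcases h1 with h1 | h1
      · exact absurd (Circle.ext h1) hz
      · rw [h1]; exact Submodule.zero_mem _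

end IsTrimmable
end DirectedGraph

/-! ### The path space representation -/

section PEquivOp

/-- The Hilbert space `ℓ²(X)`. -/
abbrev ℓTwo (X : Type*) : Type _ := lp (fun _ : X => ℂ) 2

open scoped InnerProductSpace ENNReal

variable {X : Type*}

/-- The transport of a function along a partial bijection, extended by zero. -/
def PEquiv.transport (σ : X ≃. X) (f : X → ℂ) (x : X) : ℂ := (σ.symm x).elim 0 f

namespace PEquiv

variable (σ : X ≃. X)

theorem transport_of_mem {f : X → ℂ} {x y : X} (h : y ∈ σ x) : σ.transport f y = f x := by
  rw [transport, (σ.mem_iff_mem.2 h : σ.symm y = some x)]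
  rfl

theorem transport_of_not_mem {f : X → ℂ} {y : X} (h : ∀ x, y ∉ σ x) : σ.transport f y = 0 := by
  rw [transport]
  cases hy : σ.symm y with
  | none => rfl
  | some x => exact absurd (σ.mem_iff_mem.1 hy) (h x)

/-- The graph of a partial bijection. -/
abbrev Graph : Type _ := {z : X × X // z.2 ∈ σ z.1}

theorem graph_fst_injective : Function.Injective fun z : σ.Graph => z.1.1 := by
  rintro ⟨⟨x, y⟩, h⟩ ⟨⟨x', y'⟩, h'⟩ (rfl : x = x')
  have : y = y' := Option.mem_unique h h'
  subst this
  rfl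

theorem graph_snd_injective : Function.Injective fun z : σ.Graph => z.1.2 := by
  rintro ⟨⟨x, y⟩, h⟩ ⟨⟨x', y'⟩, h'⟩ (rfl : y = y')
  have : x = x' := σ.inj h h'
  subst this
  rfl

theorem support_subset_range_snd {M : Type*} [Zero M] (F : X → M)
    (hF : ∀ y, (∀ x, y ∉ σ x) → F y = 0) :
    Function.support F ⊆ Set.range fun z : σ.Graph => z.1.2 := by
  intro y hy
  by_contra hh
  exact hy (hF y fun x hx => hh ⟨⟨(x, y), hx⟩, rfl⟩)

theorem support_subset_range_fst {M : Type*} [Zero M] (F : X → M)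
    (hF : ∀ x, (∀ y, y ∉ σ x) → F x = 0) :
    Function.support F ⊆ Set.range fun z : σ.Graph => z.1.1 := by
  intro x hx
  by_contra hh
  exact hx (hF x fun y hy => hh ⟨⟨(x, y), hy⟩, rfl⟩)

theorem summable_norm_sq (f : ℓTwo X) : Summable fun x => ‖f x‖ ^ 2 := by
  have := (lp.memℓp f).summable (by norm_num)
  simpa using this

theorem norm_transport_sq (f : ℓTwo X) :
    Summable (fun x => ‖σ.transport f x‖ ^ 2) ∧
      ∑' x, ‖σ.transport f x‖ ^ 2 ≤ ∑' x, ‖f x‖ ^ 2 := by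
  have hsupp := σ.support_subset_range_snd (fun x => ‖σ.transport f x‖ ^ 2) fun y hy => by
    simp only [σ.transport_of_not_mem hy, norm_zero, zero_pow two_ne_zero]
  have hcomp : (fun x => ‖σ.transport f x‖ ^ 2) ∘ (fun z : σ.Graph => z.1.2) =
      (fun x => ‖f x‖ ^ 2) ∘ fun z : σ.Graph => z.1.1 := by
    ext z
    simp only [Function.comp_apply, σ.transport_of_mem z.2]
  constructor
  · rw [← σ.graph_snd_injective.summable_iff (fun x hx => by
      by_contra hh; exact hx (hsupp hh)), hcomp]
    exact (summable_norm_sq f).comp_injective σ.graph_fst_injective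
  · rw [← σ.graph_snd_injective.tsum_eq hsupp]
    change ∑' z, ((fun x => ‖σ.transport f x‖ ^ 2) ∘ fun z : σ.Graph => z.1.2) z ≤ _
    rw [hcomp]
    exact tsum_comp_le_tsum_of_inj (summable_norm_sq f) (fun x => by positivity)
      σ.graph_fst_injective

/-- The partial isometry of `ℓ²(X)` given by a partial bijection of `X`. -/
def op : ℓTwo X →L[ℂ] ℓTwo X :=
  LinearMap.mkContinuous
    { toFun := fun f => ⟨σ.transport f, memℓp_gen (by simpa using (σ.norm_transport_sq f).1)⟩
      map_add' := fun f g => by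
        ext x
        change σ.transport (f + g) x = σ.transport f x + σ.transport g x
        simp only [transport]
        cases σ.symm x <;> simp
      map_smul' := fun c f => by
        ext x
        change σ.transport (c • f) x = c • σ.transport f x
        simp only [transport]
        cases σ.symm x <;> simp } 1 fun f => by
    rw [one_mul]
    refine lp.norm_le_of_tsum_le (by norm_num) (norm_nonneg f) ?_
    rw [lp.norm_rpow_eq_tsum (by norm_num) f]
    simpa using (σ.norm_transport_sq f).2

theorem op_apply (f : ℓTwo X) (x : X) : σ.op f x = σ.transport f x := rfl

theorem op_mul_op (τ : X ≃. X) : σ.op * τ.op = (τ.trans σ).op := by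
  ext f x
  change σ.transport (τ.transport f) x = (τ.trans σ).transport f x
  have : (τ.trans σ).symm x = (σ.symm x).bind τ.symm := rfl
  rw [transport, transport, this]
  cases σ.symm x <;> rfl

theorem star_op : star σ.op = σ.symm.op := by
  rw [ContinuousLinearMap.star_eq_adjoint, eq_comm, ContinuousLinearMap.eq_adjoint_iff]
  intro f g
  rw [lp.inner_eq_tsum, lp.inner_eq_tsum]
  rw [← σ.graph_fst_injective.tsum_eq (σ.support_subset_range_fst _ ?_),
    ← σ.graph_snd_injective.tsum_eq (σ.support_subset_range_snd _ ?_)]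
  · refine tsum_congr fun z => ?_
    rw [op_apply, op_apply, σ.transport_of_mem z.2, σ.symm.transport_of_mem (σ.mem_iff_mem.2 z.2)]
  · intro y hy
    rw [op_apply, σ.transport_of_not_mem hy, inner_zero_right]
  · intro x hx
    rw [op_apply, σ.symm.transport_of_not_mem (fun y hy => hx y (σ.mem_iff_mem.1 hy)),
      inner_zero_left]

/-- The value of a square-summable function at a point. -/
def coord (x : X) : ℓTwo X →ₗ[ℂ] ℂ where
  toFun f := f x
  map_add' _ _ := rfl
  map_smul' _ _ := rfl

theorem hom_ext_coord {S T : ℓTwo X →L[ℂ] ℓTwo X} (h : ∀ f x, coord x (S f) = coord x (T f)) :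
    S = T := by
  ext f x
  exact h f x

theorem coord_op_ofSet (s : Set X) [DecidablePred (· ∈ s)] (f : ℓTwo X) (x : X) :
    coord x ((PEquiv.ofSet s).op f) = if x ∈ s then coord x f else 0 := by
  change (PEquiv.ofSet s).transport f x = _
  split_ifs with h
  · exact transport_of_mem _ (PEquiv.mem_ofSet_self_iff.2 h)
  · refine transport_of_not_mem _ fun y hy => h ?_
    obtain ⟨rfl, hs⟩ := PEquiv.mem_ofSet_iff.1 hy
    exact hs

end PEquiv

end PEquivOp

namespace DirectedGraph

open scoped InnerProductSpace ENNReal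

variable {V W : Type*} (E : DirectedGraph V W) (v₀ : V) (e₀ : W)

open Classical in
/-- Prolonging paths that end in `v₀` by the edge `e`, as a partial bijection. -/
def consPEquiv (e : W) : List W ≃. List W where
  toFun l := if E.IsPathTo v₀ e₀ (e :: l) then some (e :: l) else none
  invFun l := if E.IsPathTo v₀ e₀ l ∧ l.head? = some e then some l.tail else none
  inv l m := by
    constructor
    · intro h
      split_ifs at h with hm
      obtain ⟨hm, hm'⟩ := hm
      rcases m with _ | ⟨f, m⟩
      · simp at hm'
      · simp only [List.head?_cons, Option.some.injEq] at hm'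
        simp only [List.tail_cons, Option.some.injEq] at h
        subst hm' h
        exact if_pos hm
    · intro h
      split_ifs at h with hl
      simp only [Option.some.injEq] at h
      subst h
      exact if_pos ⟨hl, rfl⟩

variable {E v₀ e₀}

open Classical in
/-- The path space representation: `P v` is the projection of `ℓ²` onto the paths starting in `v`,
and `S e` prolongs paths by `e`. -/
theorem IsTrimmable.pathSpace_family (h : E.IsTrimmable v₀ e₀) :
    (E.deleteEdge e₀).IsCKFamily (A := ℓTwo (List W) →L[ℂ] ℓTwo (List W))
      (fun v => (PEquiv.ofSet {l | E.IsPathTo v₀ e₀ l ∧ E.pathStart v₀ l = v}).op)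
      (fun e => (consPEquiv E v₀ e₀ e.1).op) := by
  have hSS : ∀ e : W, (consPEquiv E v₀ e₀ e).op * star (consPEquiv E v₀ e₀ e).op =
      (PEquiv.ofSet {l | E.IsPathTo v₀ e₀ l ∧ l.head? = some e}).op := fun e => by
    rw [PEquiv.star_op, PEquiv.op_mul_op, PEquiv.symm_trans_self]
    congr 2
    ext l
    change (if _ then _ else _ : Option _).isSome = true ↔ _
    split_ifs with hl <;> simp [hl]
  have hS : ∀ e : W, e ≠ e₀ → star (consPEquiv E v₀ e₀ e).op * (consPEquiv E v₀ e₀ e).op =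
      (PEquiv.ofSet {l | E.IsPathTo v₀ e₀ l ∧ E.pathStart v₀ l = E.rng e}).op := fun e he => by
    rw [PEquiv.star_op, PEquiv.op_mul_op, PEquiv.self_trans_symm]
    congr 2
    ext l
    change (if _ then _ else _ : Option _).isSome = true ↔ _
    split_ifs with hl
    · simpa using ⟨hl.2.2, hl.2.1.symm⟩
    · simp only [Option.isSome_none, Bool.false_eq_true, false_iff]
      exact fun hh => hl ⟨he, hh.2.symm, hh.1⟩
  refine ⟨fun v => ?_, fun v => ?_, fun v w hvw => ?_, fun e => ?_, fun e => hS e.1 e.2,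
    fun v t ht ht' => ?_⟩
  · rw [PEquiv.star_op, PEquiv.ofSet_symm]
  · refine PEquiv.hom_ext_coord fun f l => ?_
    rw [mul_apply_eq_comp, PEquiv.coord_op_ofSet, PEquiv.coord_op_ofSet]
    split_ifs <;> rfl
  · refine PEquiv.hom_ext_coord fun f l => ?_
    rw [mul_apply_eq_comp, PEquiv.coord_op_ofSet, PEquiv.coord_op_ofSet]
    split_ifs with h1 h2
    · exact absurd (h1.2.symm.trans h2.2) hvw
    · rfl
    · rfl
  · rw [hSS]
    refine PEquiv.hom_ext_coord fun f l => ?_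
    rw [mul_apply_eq_comp, PEquiv.coord_op_ofSet]
    split_ifs with h1
    · rfl
    · have h2 : (consPEquiv E v₀ e₀ e.1).symm l = none := if_neg h1
      exact (congrArg (fun o : Option (List W) => o.elim 0 f) h2).symm
  · simp only [hSS]
    refine PEquiv.hom_ext_coord fun f l => ?_
    rw [sum_apply, map_sum]
    simp only [PEquiv.coord_op_ofSet, Set.mem_ofPred_eq]
    rcases l with _ | ⟨e, l⟩
    · rw [if_neg, Finset.sum_eq_zero fun e _ => if_neg fun hh => by simpa using hh.2]
      rintro ⟨-, hv⟩
      obtain ⟨e, he⟩ := ht'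
      exact e.2 (h.src_eq_iff.1 (((ht e).1 he).trans hv.symm))
    · by_cases hl : E.IsPathTo v₀ e₀ (e :: l) ∧ E.pathStart v₀ (e :: l) = v
      · rw [if_pos hl, Finset.sum_eq_single_of_mem ⟨e, hl.1.1⟩ ((ht ⟨e, hl.1.1⟩).2 hl.2), if_pos ⟨hl.1, rfl⟩]
        intro f _ hfe
        refine if_neg fun hh => hfe (Subtype.ext ?_)
        simpa using hh.2.symm
      · rw [if_neg hl]
        refine Finset.sum_eq_zero fun f hf => if_neg fun hh => hl ⟨hh.1, ?_⟩
        have h1 : e = f.1 := by simpa using hh.2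
        subst h1
        exact (ht f).1 hf

/-- The projection at the sink `v₀` of the graph without the loop is nonzero. -/
theorem IsTrimmable.P_deleteEdge_ne_zero (h : E.IsTrimmable v₀ e₀) :
    CStar.P (E.deleteEdge e₀) v₀ ≠ 0 := by
  classical
  intro h0
  have h1 := CStar.lift_P h.pathSpace_family v₀
  rw [h0, map_zero] at h1
  have h2 := congrArg (fun T : ℓTwo (List W) →L[ℂ] ℓTwo (List W) =>
    PEquiv.coord [] (T (lp.single 2 [] 1))) h1
  have h3 : PEquiv.coord ([] : List W) (lp.single 2 [] (1 : ℂ)) = 1 :=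
    lp.single_apply_self (E := fun _ : List W => ℂ) 2 [] 1
  simp only [PEquiv.coord_op_ofSet, h3] at h2
  rw [if_pos ⟨trivial, rfl⟩] at h2
  exact zero_ne_one h2

end DirectedGraph

/-! ### Matrix units -/

section MatrixUnits

open scoped ComplexOrder

variable {A : Type*} [NonUnitalCStarAlgebra A] {ι : Type*} [Fintype ι] [DecidableEq ι]

/-- The `*`-homomorphism from a matrix algebra given by the matrix units `t i * star (t j)`, where
the `t i` are partial isometries with common initial projection `p` and orthogonal ranges. -/
def matrixUnitHom (t : ι → A) (p : A) (h : ∀ i j, star (t i) * t j = if i = j then p else 0)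
    (hp : ∀ i, t i * p = t i) : CStarMatrix ι ι ℂ →⋆ₙₐ[ℂ] A where
  toFun M := ∑ i, ∑ j, M i j • (t i * star (t j))
  map_smul' c M := by
    simp only [CStarMatrix.smul_apply, smul_assoc, Finset.smul_sum, MonoidHom.id_apply]
  map_zero' := by simp
  map_add' M N := by
    simp only [CStarMatrix.add_apply, add_smul, Finset.sum_add_distrib]
  map_mul' M N := by
    have h1 : ∀ i j k l, (t i * star (t j)) * (t k * star (t l)) =
        if j = k then t i * star (t l) else 0 := by
      intro i j k l
      rw [mul_assoc, ← mul_assoc (star (t j)), h]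
      split_ifs
      · rw [← mul_assoc, hp]
      · rw [zero_mul, mul_zero]
    simp only [Finset.sum_mul, Finset.mul_sum, smul_mul_smul_comm, h1, smul_ite, smul_zero,
      Finset.sum_ite_eq', Finset.mem_univ, if_true, CStarMatrix.mul_apply, Finset.sum_smul]
    rw [Finset.sum_comm]
    conv_rhs => rw [Finset.sum_comm]
    exact Finset.sum_congr rfl fun l _ => Finset.sum_comm
  map_star' M := by
    simp only [star_sum, star_smul, star_mul, star_star]
    rw [Finset.sum_comm]
    rfl

theorem matrixUnitHom_injective {t : ι → A} {p : A}
    (h : ∀ i j, star (t i) * t j = if i = j then p else 0) (hp : ∀ i, t i * p = t i)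
    (hp0 : p ≠ 0) : Function.Injective (matrixUnitHom t p h hp) := by
  rw [injective_iff_map_eq_zero]
  intro M hM
  ext i j
  have h1 : star (t i) * matrixUnitHom t p h hp M * t j = M i j • (p * p) := by
    change star (t i) * (∑ i, ∑ j, M i j • (t i * star (t j))) * t j = _
    simp only [Finset.mul_sum, Finset.sum_mul, mul_smul_comm, smul_mul_assoc, ← mul_assoc, h]
    simp only [mul_assoc, h]
    rw [Finset.sum_eq_single_of_mem i (Finset.mem_univ _) fun k _ hk => ?_,
      Finset.sum_eq_single_of_mem j (Finset.mem_univ _) fun k _ hk => ?_]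
    · rw [if_pos rfl, if_pos rfl]
    · rw [if_neg hk, mul_zero, smul_zero]
    · exact Finset.sum_eq_zero fun l _ => by rw [if_neg hk.symm, zero_mul, smul_zero]
  have h2 : p * p = p := by
    have h3 : star (t i) * t i = p := by rw [h, if_pos rfl]
    nth_rw 1 [← h3]
    rw [mul_assoc, hp, h3]
  rw [hM, mul_zero, zero_mul, h2] at h1
  exact (smul_eq_zero.1 h1.symm).resolve_right hp0

end MatrixUnits

namespace DirectedGraph

variable {V W : Type*} {E : DirectedGraph V W} {v₀ : V} {e₀ : W}
variable {A B : Type*} [NonUnitalCStarAlgebra A] [NonUnitalCStarAlgebra B] {P : V → A} {S : W → A}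

theorem CKRelations.map (hF : E.IsCKFamily P S) (g : A →⋆ₙₐ[ℂ] B) :
    E.IsCKFamily (fun v => g (P v)) (fun e => g (S e)) where
  star_proj v := by rw [← map_star, hF.star_proj]
  proj_mul_proj v := by rw [← map_mul, hF.proj_mul_proj]
  orthogonal v w hvw := by rw [← map_mul, hF.orthogonal v w hvw, map_zero]
  partialIsometry e := by rw [← map_star, ← map_mul, ← map_mul, hF.partialIsometry]
  ck1 e := by rw [← map_star, ← map_mul, hF.ck1]
  ck2 v t ht ht' := by rw [← hF.ck2 v t ht ht', map_sum]; simp only [map_mul, map_star]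

theorem map_pathT (g : A →⋆ₙₐ[ℂ] B) (l : List W) :
    g (pathT P S v₀ e₀ l) = pathT (fun v => g (P v)) (fun e => g (S e)) v₀ e₀ l := by
  induction l with
  | nil => rfl
  | cons e l ih => rw [pathT, pathT, map_mul, map_mul, map_star, ih]

namespace IsTrimmable

open scoped ComplexOrder in
/-- The norm of a linear combination of matrix units is the norm of the matrix of coefficients. -/
theorem norm_sum_matrixUnits (h : E.IsTrimmable v₀ e₀) (hF : E.IsCKFamily P S) (hP : P v₀ ≠ 0)
    {c : E.PathTo v₀ e₀ × E.PathTo v₀ e₀ →₀ ℂ} {F : Finset (E.PathTo v₀ e₀)}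
    (hsub : c.support ⊆ F ×ˢ F) :
    ‖c.sum fun z a => a • (pathT P S v₀ e₀ z.1 * star (pathT P S v₀ e₀ z.2))‖ =
      ‖(CStarMatrix.ofMatrix fun i j => c (i.1, j.1) : CStarMatrix F F ℂ)‖ := by
  classical
  have h1 : ∀ i j : F, star (pathT P S v₀ e₀ i.1.1) * pathT P S v₀ e₀ j.1.1 =
      if i = j then P v₀ else 0 := fun i j => by
    rw [h.star_pathT_mul hF]
    simp only [Subtype.ext_iff]
  rw [← NonUnitalStarAlgHom.norm_map _ (matrixUnitHom_injective h1
    (fun i => h.pathT_mul_P hF i.1.1) hP), Finsupp.sum_of_support_subset _ hsub _ (by simp),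
    Finset.sum_product, ← Finset.sum_coe_sort F]
  congr 1
  refine Finset.sum_congr rfl fun i _ => ?_
  rw [← Finset.sum_coe_sort F]
  rfl

/-- A `*`-homomorphism that does not annihilate `P v₀` is isometric on the closed span of the
matrix units, since both norms are given by the norm of the matrix of coefficients. -/
theorem norm_map_of_mem_matrixUnitSpan (h : E.IsTrimmable v₀ e₀) (hF : E.IsCKFamily P S)
    (g : A →⋆ₙₐ[ℂ] B) (hg : g (P v₀) ≠ 0) {x : A} (hx : x ∈ matrixUnitSpan E v₀ e₀ P S) :
    ‖g x‖ = ‖x‖ := by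
  classical
  refine closure_minimal (t := {x | ‖g x‖ = ‖x‖}) ?_
    (isClosed_eq (continuous_starHom g).norm continuous_norm) hx
  intro y hy
  have hrange : {x | ∃ (μ ν : E.PathTo v₀ e₀), x = pathT P S v₀ e₀ μ *
      star (pathT P S v₀ e₀ ν)} = Set.range fun z : E.PathTo v₀ e₀ × E.PathTo v₀ e₀ =>
      pathT P S v₀ e₀ z.1 * star (pathT P S v₀ e₀ z.2) := by
    ext x
    constructor
    · rintro ⟨μ, ν, rfl⟩; exact ⟨(μ, ν), rfl⟩
    · rintro ⟨z, rfl⟩; exact ⟨z.1, z.2, rfl⟩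
  rw [hrange] at hy
  obtain ⟨c, rfl⟩ := Finsupp.mem_span_range_iff_exists_finsupp.1 hy
  let F : Finset (E.PathTo v₀ e₀) := c.support.image Prod.fst ∪ c.support.image Prod.snd
  have hsub : c.support ⊆ F ×ˢ F := fun z hz => Finset.mem_product.2
    ⟨Finset.mem_union_left _ (Finset.mem_image_of_mem _ hz),
      Finset.mem_union_right _ (Finset.mem_image_of_mem _ hz)⟩
  change ‖g (c.sum _)‖ = ‖c.sum _‖
  rw [h.norm_sum_matrixUnits hF (fun h0 => hg (by rw [h0, map_zero])) hsub, Finsupp.sum, map_sum]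
  simp only [map_smul, map_mul, map_star, map_pathT]
  exact h.norm_sum_matrixUnits (hF.map g) hg hsub

/-- The image of the closed span of the matrix units is closed, because it is the image of a complete
space under an isometry, and thus contains the closed span of the images. -/
theorem exists_map_eq_of_mem_matrixUnitSpan (h : E.IsTrimmable v₀ e₀) (hF : E.IsCKFamily P S)
    (g : A →⋆ₙₐ[ℂ] B) (hg : g (P v₀) ≠ 0) {y : B}
    (hy : y ∈ matrixUnitSpan E v₀ e₀ (fun v => g (P v)) (fun e => g (S e))) :
    ∃ x ∈ matrixUnitSpan E v₀ e₀ P S, g x = y := by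
  let K := matrixUnitSpan E v₀ e₀ P S
  have : CompleteSpace K := (isClosed_matrixUnitSpan).completeSpace_coe
  let φ : K →ₗ[ℂ] B := (g : A →ₗ[ℂ] B).comp K.subtype
  have hφ : Isometry φ := AddMonoidHomClass.isometry_of_norm φ fun x =>
    h.norm_map_of_mem_matrixUnitSpan hF g hg x.2
  have hcl : IsClosed (φ.range : Set B) := hφ.isClosedEmbedding.isClosed_range
  have hle : matrixUnitSpan E v₀ e₀ (fun v => g (P v)) (fun e => g (S e)) ≤ φ.range := by
    refine Submodule.topologicalClosure_minimal _ (Submodule.span_le.2 ?_) hcl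
    rintro _ ⟨μ, ν, rfl⟩
    refine ⟨⟨_, Submodule.le_topologicalClosure _ (Submodule.subset_span ⟨μ, ν, rfl⟩)⟩, ?_⟩
    change g (pathT P S v₀ e₀ μ * star (pathT P S v₀ e₀ ν)) = _
    rw [map_mul, map_star, map_pathT, map_pathT]
  obtain ⟨x, rfl⟩ := hle hy
  exact ⟨x, x.2, rfl⟩

/-! ### The pullback diagram -/

/-- The composition of `f` with the evaluation of functions on the circle at `1`. It sends the loop
`S e₀` to `P v₀` and all other generators to those of the same name. -/
def fEval (h : E.IsTrimmable v₀ e₀) : E.CStar →⋆ₙₐ[ℂ] (E.deleteEdge e₀).CStar :=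
  NonUnitalStarAlgHom.comp
    { toFun := fun k : C(Circle, (E.deleteEdge e₀).CStar) => k 1
      map_smul' := fun _ _ => rfl
      map_zero' := rfl
      map_add' := fun _ _ => rfl
      map_mul' := fun _ _ => rfl
      map_star' := fun _ => rfl } h.f

theorem fEval_P (h : E.IsTrimmable v₀ e₀) (v : V) :
    h.fEval (CStar.P E v) = CStar.P (E.deleteEdge e₀) v := by
  change h.f (CStar.P E v) 1 = _
  rw [f, CStar.lift_P]
  exact one_smul ℂ _

theorem fEval_S_of_ne (h : E.IsTrimmable v₀ e₀) {e : W} (he : e ≠ e₀) :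
    h.fEval (CStar.S E e) = CStar.S (E.deleteEdge e₀) ⟨e, he⟩ := by
  change h.f (CStar.S E e) 1 = _
  rw [f, CStar.lift_S, fS_of_ne he]
  exact one_smul ℂ _

theorem fEval_S_loop (h : E.IsTrimmable v₀ e₀) :
    h.fEval (CStar.S E e₀) = CStar.P (E.deleteEdge e₀) v₀ := by
  change h.f (CStar.S E e₀) 1 = _
  rw [f, CStar.lift_S, fS_self]
  exact one_smul ℂ _

theorem pi₁_P (h : E.IsTrimmable v₀ e₀) (v : V) : h.pi₁ (CStar.P E v) = E.quotP v₀ v :=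
  CStar.lift_P _ _

theorem pi₁_S (h : E.IsTrimmable v₀ e₀) (e : W) : h.pi₁ (CStar.S E e) = E.quotS v₀ e :=
  CStar.lift_S _ _

theorem pi₂_fEval_P (h : E.IsTrimmable v₀ e₀) (v : V) :
    h.pi₂ (h.fEval (CStar.P E v)) = E.quotP v₀ v := by
  rw [fEval_P, pi₂, CStar.lift_P]

theorem pi₂_fEval_S (h : E.IsTrimmable v₀ e₀) (e : W) :
    h.pi₂ (h.fEval (CStar.S E e)) = E.quotS v₀ e := by
  by_cases he : e = e₀
  · subst he
    rw [fEval_S_loop, pi₂, CStar.lift_P, quotP_self, quotS_of_not fun hh => hh.1 h.src_loop]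
  · rw [fEval_S_of_ne h he, pi₂, CStar.lift_S]

theorem pi₂_fEval (h : E.IsTrimmable v₀ e₀) (x : E.CStar) : h.pi₂ (h.fEval x) = h.pi₁ x := by
  have : h.pi₂.comp h.fEval = h.pi₁ := CStar.hom_ext
    (fun v => (h.pi₂_fEval_P v).trans (h.pi₁_P v).symm)
    (fun e => (h.pi₂_fEval_S e).trans (h.pi₁_S e).symm)
  exact DFunLike.congr_fun this x

theorem generates_fEval (h : E.IsTrimmable v₀ e₀) :
    Generates (fun v => h.fEval (CStar.P E v)) (fun e => h.fEval (CStar.S E e)) :=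
  fun B hB hP hS => CStar.generates _ B hB (fun v => h.fEval_P v ▸ hP v)
    (fun e => h.fEval_S_of_ne e.2 ▸ hS e.1)

theorem fEval_P_ne_zero (h : E.IsTrimmable v₀ e₀) : h.fEval (CStar.P E v₀) ≠ 0 := by
  rw [fEval_P]
  exact h.P_deleteEdge_ne_zero

/-- In the ideal for the family `fEval (P v)`, `fEval (S e)` the loop is the projection `P v₀`
itself, so that the matrix units already span. -/
theorem loopIdeal_fEval_le (h : E.IsTrimmable v₀ e₀) :
    loopIdeal E v₀ e₀ (fun v => h.fEval (CStar.P E v)) (fun e => h.fEval (CStar.S E e)) ≤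
      matrixUnitSpan E v₀ e₀ (fun v => h.fEval (CStar.P E v))
        (fun e => h.fEval (CStar.S E e)) := by
  have hF := (CStar.isCKFamily E).map h.fEval
  have hS : h.fEval (CStar.S E e₀) = h.fEval (CStar.P E v₀) := by rw [fEval_S_loop, fEval_P]
  refine Submodule.topologicalClosure_mono (Submodule.span_mono ?_)
  rintro _ ⟨μ, ν, k, rfl⟩
  refine ⟨μ, ν, ?_⟩
  have hpow : loopPow (h.fEval (CStar.P E v₀)) (h.fEval (CStar.S E e₀)) k =
      h.fEval (CStar.P E v₀) := by
    have h1 : h.fEval (CStar.P E v₀) * h.fEval (CStar.P E v₀) = h.fEval (CStar.P E v₀) :=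
      hF.proj_mul_proj v₀
    have h2 : star (h.fEval (CStar.P E v₀)) = h.fEval (CStar.P E v₀) := hF.star_proj v₀
    rw [hS]
    rcases k with n | n
    · exact Function.iterate_fixed h1 n
    · exact Function.iterate_fixed (by rw [h2, h1]) (n + 1)
  rw [hpow, ← mul_assoc, h.pathT_mul_P hF]

end IsTrimmable

theorem matrixUnitSpan_le_gaugeFixed {x : E.CStar}
    (hx : x ∈ matrixUnitSpan E v₀ e₀ (CStar.P E) (CStar.S E)) : x ∈ CStar.gaugeFixed E := by
  have hle : matrixUnitSpan E v₀ e₀ (CStar.P E) (CStar.S E) ≤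
      (CStar.gaugeFixed E).toSubmodule := by
    refine Submodule.topologicalClosure_minimal _ (Submodule.span_le.2 ?_)
      (isClosed_circleFixedPoints _)
    rintro _ ⟨μ, ν, rfl⟩ z
    rw [map_mul, map_star, IsTrimmable.gauge_pathT, IsTrimmable.gauge_pathT]
  exact hle hx

end DirectedGraph

end

theorem mainTheorem2 {V W : Type*} (E : DirectedGraph V W) (v₀ : V) (e₀ : W)
    (h : E.IsTrimmable v₀ e₀) :
    IsPullbackDiagram (A := DirectedGraph.CStar.gaugeFixed E)
      (B := DirectedGraph.CStar.gaugeFixed (E.deleteVertex v₀))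
      h.pi₁Fixed h.fFixed
      (DirectedGraph.CStar.gaugeFixedIncl (E.deleteVertex v₀)) h.pi₂ := by
  have hF := DirectedGraph.CStar.isCKFamily E
  have hg := DirectedGraph.CStar.generates E
  have h0 := h.fEval_P_ne_zero
  refine ⟨fun a => (h.pi₂_fEval a).symm, fun a b hab => ?_, ?_⟩
  · have h1 : h.fEval (a - b : E.CStar) = 0 := by
      rw [map_sub, sub_eq_zero]
      exact congrArg (fun z => z.1.2) hab
    have h2 : h.pi₁ (a - b : E.CStar) = 0 := by rw [← h.pi₂_fEval, h1, map_zero]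
    have h3 := h.mem_matrixUnitSpan
      (h.mem_loopIdeal_of_map_eq_zero hF hg h.pi₁_P h.pi₁_S h2) (sub_mem a.2 b.2)
    have h4 := h.norm_map_of_mem_matrixUnitSpan hF h.fEval h0 h3
    rw [h1, norm_zero, eq_comm, norm_eq_zero, sub_eq_zero] at h4
    exact Subtype.ext h4
  · rintro ⟨⟨⟨b, hb⟩, c⟩, hbc⟩
    replace hbc : b = h.pi₂ c := hbc
    -- lift `b` to a gauge-invariant element by averaging an arbitrary lift
    obtain ⟨a, rfl⟩ := h.map_surjective hF hg h.pi₁_P h.pi₁_S b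
    have ha : h.pi₁ (DirectedGraph.CStar.average a) = h.pi₁ a := by
      rw [DirectedGraph.CStar.map_average]
      simp only [h.pi₁_gauge]
      exact DirectedGraph.CStar.average_of_mem hb
    -- correct the lift by an element of the ideal generated by `P v₀`
    have hker : h.pi₂ (c - h.fEval (DirectedGraph.CStar.average a)) = 0 := by
      rw [map_sub, h.pi₂_fEval, ha, hbc, sub_self]
    obtain ⟨k, hk, hk'⟩ := h.exists_map_eq_of_mem_matrixUnitSpan hF h.fEval h0
      (h.loopIdeal_fEval_le (h.mem_loopIdeal_of_map_eq_zero (hF.map h.fEval) h.generates_fEval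
        h.pi₂_fEval_P h.pi₂_fEval_S hker))
    have hmem := add_mem (DirectedGraph.CStar.average_mem a)
      (DirectedGraph.matrixUnitSpan_le_gaugeFixed hk)
    have hc : h.fEval (DirectedGraph.CStar.average a + k) = c := by
      rw [map_add, hk', add_sub_cancel]
    refine ⟨⟨_, hmem⟩, Subtype.ext (Prod.ext (Subtype.ext ?_) hc)⟩
    change h.pi₁ (DirectedGraph.CStar.average a + k) = h.pi₁ a
    rw [← h.pi₂_fEval, hc, hbc]
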